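/- Let $X$ be an analytic subset of a complete separable metric space, let $Y$ be a separable metric space (both with their Borel $\sigma$-algebras), let $(\Lambda,\mathcal P)$ be a probability space, and let $\pi:\Lambda\times X\to Y$ be measurable; write $\pi_\lambda=\pi(\lambda,\cdot)$. Suppose that for some real numbers $\alpha,\kappa,C>0$ the transversality property $$\mathcal P\big[\lambda\in\Lambda:\ d(\pi_\lambda(x_1),\pi_\lambda(x_2))\le\delta\, d(x_1,x_2)^{\alpha}\big]\le C\delta^{\kappa}$$ holds for all $\delta>0$ and all $x_1\ne x_2$ in $X$. Suppose that $\dim X>\alpha\kappa$, where $\dim$ is the Hausdorff dimension. A Borel measure $\eta$ on $Y$ is called $\kappa$-regular if it is outer regular by open sets and $\liminf_{r\to0^+}\eta(B(y,r))/r^\kappa>0$ for every $y\in Y$. It is called strongly $\kappa$-regular if it is outer regular by open sets and there is $c>0$ with $\liminf_{r\to0^+}\eta(B(y,r))/r^\kappa\ge c$ for every $y\in Y$. Here $\eta(A)$ for an arbitrary set $A\subset Y$ denotes the outer measure. (i) If $\eta$ is a $\kappa$-regular measure on $Y$, then $\eta(\pi_\lambda(X))>0$ for $\mathcal P$-a.e.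 $\lambda\in\Lambda$. (ii) If $\eta$ is a strongly $\kappa$-regular and $\sigma$-finite measure on $Y$, then $\lambda\mapsto\eta(\pi_\lambda(X))^{-1}\in[0,\infty]$ is measurable with respect to the completion of $\mathcal P$, and $$\int_\Lambda\eta(\pi_\lambda(X))^{-1}\,d\mathcal P(\lambda)<\infty .$$ -/

import Mathlib

open MeasureTheory Filter
open scoped Topology ENNReal

noncomputable section

/-- The lower `κ`-density `liminf_{r → 0⁺} η(B(y, r)) / r ^ κ`, as an element of `[0, ∞]`,
with `B(y, r)` the closed ball. -/
def kappaDensity {Y : Type*} [MetricSpace Y] [MeasurableSpace Y]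
    (κ : ℝ) (η : Measure Y) (y : Y) : ℝ≥0∞ :=
  liminf (fun r : ℝ => η (Metric.closedBall y r) / ENNReal.ofReal (r ^ κ)) (𝓝[>] (0 : ℝ))

/-- A `κ`-regular Borel measure: outer regular by open sets, with positive lower `κ`-density at
every point. -/
structure IsKappaRegular {Y : Type*} [MetricSpace Y] [MeasurableSpace Y] [BorelSpace Y]
    (κ : ℝ) (η : Measure Y) : Prop where
  outerRegular : η.OuterRegular
  density_pos : ∀ y : Y, 0 < kappaDensity κ η y

/-- A strongly `κ`-regular Borel measure: outer regular by open sets, with lower `κ`-density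
bounded below by one positive constant at all points. -/
structure IsStronglyKappaRegular {Y : Type*} [MetricSpace Y] [MeasurableSpace Y] [BorelSpace Y]
    (κ : ℝ) (η : Measure Y) : Prop where
  outerRegular : η.OuterRegular
  density_ge : ∃ c : ℝ≥0∞, 0 < c ∧ ∀ y : Y, c ≤ kappaDensity κ η y

/-- Transversality of the family `π ω : X → Y`, `ω ∈ Λ`, with parameters `α`, `κ`, `C`.
The points are distinct: for `x₁ = x₂` the event is all of `Λ`. -/
def IsTransversal {X Y Λ : Type*} [MetricSpace X] [MetricSpace Y] [MeasurableSpace Λ]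
    (P : Measure Λ) (π : Λ → X → Y) (α κ C : ℝ) : Prop :=
  ∀ δ : ℝ, 0 < δ → ∀ x₁ x₂ : X, x₁ ≠ x₂ →
    P {ω | dist (π ω x₁) (π ω x₂) ≤ δ * dist x₁ x₂ ^ α} ≤ ENNReal.ofReal (C * δ ^ κ)

end

/-!
For a probability measure `μ` on `X` and a fixed `λ`, compare the lower `κ`-density of the image
measure `(π_λ)_* μ` along dyadic radii with that of `η`. On the set where the former is below `M`
and the latter above `c`, the Vitali covering lemma gives `(π_λ)_* μ ≤ (5 ^ κ M / c) η`. So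
`η (π_λ X) > 0` if the density of `(π_λ)_* μ` is `μ`-integrable, and by Markov's inequality
`η (π_λ X)⁻¹` is bounded by an affine function of its integral. By Fatou's lemma, Tonelli's theorem
and transversality, the mean over `λ` of this integral is at most `C` times the `α κ`-energy of `μ`,
and an analytic set of dimension above `α κ` carries a probability measure of finite energy.

To construct such a measure, let `f : (ℕ → ℕ) → X` be a continuous surjection and `t` slightly
below the dimension. Off a null set, every point of the image of a cylinder lies at the centre of
arbitrarily small balls of radius `r` which meet that image in content above `r ^ t / 2`. Such a
piece is covered by much smaller, well separated pieces of the same kind, and Frostman's lemma for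
this countable family gives a probability law on them. The measure is the law of `f` along a random
path in the tree obtained by iteration.
-/

noncomputable section

open Metric Set TopologicalSpace
open scoped NNReal

section Content

/-- The `t`-dimensional Hausdorff content `inf {∑ₙ (diam Uₙ) ^ t : A ⊆ ⋃ₙ Uₙ}`. -/
def hausdorffContent (X : Type*) [EMetricSpace X] (t : ℝ) : OuterMeasure X :=
  OuterMeasure.boundedBy fun U => ediam U ^ t

section EMetricSpace

variable {X : Type*} [EMetricSpace X] {t : ℝ}

lemma hausdorffContent_le (t : ℝ) (U : Set X) : hausdorffContent X t U ≤ ediam U ^ t :=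
  OuterMeasure.boundedBy_le U

lemma exists_cover_of_hausdorffContent_lt (ht : 0 < t) {A : Set X} {b : ℝ≥0∞}
    (h : hausdorffContent X t A < b) :
    ∃ U : ℕ → Set X, A ⊆ ⋃ n, U n ∧ ∑' n, ediam (U n) ^ t < b := by
  have h_empty : ediam (∅ : Set X) ^ t = 0 := by simp [ht]
  rw [hausdorffContent, OuterMeasure.boundedBy_eq_ofFunction h_empty,
    OuterMeasure.ofFunction_apply] at h
  simpa only [iInf_lt_iff, exists_prop] using h

lemma hausdorffMeasure_eq_zero_of_hausdorffContent_eq_zero [MeasurableSpace X] [BorelSpace X]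
    (ht : 0 < t) {A : Set X} (h : hausdorffContent X t A = 0) : μH[t] A = 0 := by
  have h_inv : Tendsto (fun n : ℕ => (n : ℝ≥0∞)⁻¹) atTop (𝓝 0) :=
    ENNReal.tendsto_inv_nat_nhds_zero
  choose U hAU hU using fun n : ℕ =>
    exists_cover_of_hausdorffContent_lt ht (A := A) (b := (n : ℝ≥0∞)⁻¹) (by simp [h])
  have h_diam (n i : ℕ) : ediam (U n i) ≤ ((n : ℝ≥0∞)⁻¹) ^ t⁻¹ := by
    rw [ENNReal.le_rpow_inv_iff ht]
    exact (ENNReal.le_tsum i).trans (hU n).le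
  have h_root : Tendsto (fun n : ℕ => ((n : ℝ≥0∞)⁻¹) ^ t⁻¹) atTop (𝓝 0) := by
    simpa [inv_pos.2 ht] using h_inv.ennrpow_const t⁻¹
  refine le_antisymm ?_ zero_le
  calc μH[t] A
      ≤ liminf (fun n => ∑' i, ediam (U n i) ^ t) atTop :=
        Measure.hausdorffMeasure_le_liminf_tsum t A _ h_root U (.of_forall h_diam)
          (.of_forall hAU)
    _ ≤ liminf (fun n : ℕ => (n : ℝ≥0∞)⁻¹) atTop :=
        liminf_le_liminf (.of_forall fun n => (hU n).le)
    _ = 0 := h_inv.liminf_eq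

/-- Summing the hypothesis over an almost optimal cover of `S` improves the content of `S` by a
factor close to `2`. -/
lemma hausdorffContent_eq_zero_of_inter_le_half (ht : 0 < t) {S : Set X}
    (hfin : hausdorffContent X t S ≠ ∞)
    (hS : ∀ U : Set X, hausdorffContent X t (S ∩ U) ≤ ediam U ^ t / 2) :
    hausdorffContent X t S = 0 := by
  by_contra hne
  have hlt : hausdorffContent X t S < 2 * hausdorffContent X t S := by
    rw [two_mul]
    exact ENNReal.lt_add_right hfin hne
  obtain ⟨U, hSU, hU⟩ := exists_cover_of_hausdorffContent_lt ht hlt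
  refine lt_irrefl (hausdorffContent X t S) ?_
  calc hausdorffContent X t S
      ≤ hausdorffContent X t (⋃ n, S ∩ U n) :=
        measure_mono (by rw [← inter_iUnion]; exact subset_inter subset_rfl hSU)
    _ ≤ ∑' n, hausdorffContent X t (S ∩ U n) := measure_iUnion_le _
    _ ≤ ∑' n, ediam (U n) ^ t / 2 := ENNReal.tsum_le_tsum fun n => hS _
    _ = (∑' n, ediam (U n) ^ t) / 2 := by simp only [div_eq_mul_inv, ENNReal.tsum_mul_right]
    _ < hausdorffContent X t S := by
        rw [ENNReal.div_lt_iff (by simp) (by simp), mul_comm]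
        exact hU

end EMetricSpace

variable {X : Type*} [MetricSpace X] {t : ℝ}

lemma ediam_closedBall_le_two_mul (x : X) (r : ℝ≥0) : ediam (closedBall x (r : ℝ)) ≤ 2 * r := by
  rw [← closedEBall_coe]
  exact ediam_closedEBall_le

/-- The points of `A` near which `A` has `t`-dimensional content at most half of `r ^ t` in every
small ball of radius `r`. -/
def sparsePoints (t : ℝ) (A : Set X) : Set X :=
  {x ∈ A | ∀ᶠ r : ℝ≥0 in 𝓝[>] 0, hausdorffContent X t (A ∩ closedBall x r) ≤ (r : ℝ≥0∞) ^ t / 2}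

lemma hausdorffContent_eq_zero_of_sparse_of_ediam_le (ht : 0 < t) {A S : Set X} {r₀ : ℝ≥0}
    (hSA : S ⊆ A) (hdiam : ediam S ≤ r₀)
    (hS : ∀ x ∈ S, ∀ r ∈ Ioc 0 r₀,
      hausdorffContent X t (A ∩ closedBall x r) ≤ (r : ℝ≥0∞) ^ t / 2) :
    hausdorffContent X t S = 0 := by
  refine hausdorffContent_eq_zero_of_inter_le_half ht ?_ fun U => ?_
  · refine ne_top_of_le_ne_top ?_ (hausdorffContent_le t S)
    exact ENNReal.rpow_ne_top_of_nonneg ht.le (ne_top_of_le_ne_top ENNReal.coe_ne_top hdiam)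
  rcases (S ∩ U).eq_empty_or_nonempty with h_empty | ⟨x, hxS, hxU⟩
  · simp [h_empty]
  obtain ⟨d, hd, hdr⟩ := ENNReal.le_coe_iff.1 ((ediam_mono inter_subset_left).trans hdiam)
  have hdU : (d : ℝ≥0∞) ≤ ediam U := hd ▸ ediam_mono inter_subset_right
  rcases eq_zero_or_pos d with rfl | hd_pos
  · refine (hausdorffContent_le t _).trans ?_
    simp [hd, ht]
  have h_sub : S ∩ U ⊆ A ∩ closedBall x d := fun y hy => by
    refine ⟨hSA hy.1, ?_⟩
    rw [← closedEBall_coe, mem_closedEBall, ← hd]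
    exact edist_le_ediam_of_mem hy ⟨hxS, hxU⟩
  calc hausdorffContent X t (S ∩ U)
      ≤ hausdorffContent X t (A ∩ closedBall x d) := measure_mono h_sub
    _ ≤ (d : ℝ≥0∞) ^ t / 2 := hS x hxS d ⟨hd_pos, hdr⟩
    _ ≤ ediam U ^ t / 2 := by gcongr

lemma exists_iUnion_ediam_le (X : Type*) [MetricSpace X] [SeparableSpace X] {r : ℝ≥0}
    (hr : 0 < r) : ∃ Q : ℕ → Set X, ⋃ n, Q n = univ ∧ ∀ n, ediam (Q n) ≤ r := by
  rcases isEmpty_or_nonempty X with hX | hX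
  · exact ⟨fun _ => ∅, Subsingleton.elim _ _, by simp⟩
  refine ⟨fun n => closedBall (denseSeq X n) (r / 2 : ℝ≥0), eq_univ_of_forall fun x => ?_,
    fun n => (ediam_closedBall_le_two_mul _ _).trans_eq ?_⟩
  · obtain ⟨n, hn⟩ := (denseRange_denseSeq X).exists_dist_lt x (NNReal.coe_pos.2 (half_pos hr))
    exact mem_iUnion.2 ⟨n, hn.le⟩
  · rw [ENNReal.coe_div two_ne_zero]
    exact ENNReal.mul_div_cancel two_ne_zero ENNReal.ofNat_ne_top

variable [SeparableSpace X]

lemma hausdorffContent_sparsePoints (ht : 0 < t) (A : Set X) :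
    hausdorffContent X t (sparsePoints t A) = 0 := by
  have h_inv_pos (m : ℕ) : 0 < ((m : ℝ≥0) + 1)⁻¹ := by positivity
  choose Q hQ_univ hQ_diam using fun m => exists_iUnion_ediam_le X (h_inv_pos m)
  let S (m : ℕ) : Set X := {x ∈ A | ∀ r ∈ Ioc 0 ((m : ℝ≥0) + 1)⁻¹,
    hausdorffContent X t (A ∩ closedBall x r) ≤ (r : ℝ≥0∞) ^ t / 2}
  have h_sub : sparsePoints t A ⊆ ⋃ m, ⋃ n, S m ∩ Q m n := by
    rintro x ⟨hxA, hx⟩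
    obtain ⟨r₀, hr₀, h⟩ := (nhdsGT_basis (0 : ℝ≥0)).eventually_iff.1 hx
    obtain ⟨m, hm⟩ := exists_nat_gt r₀⁻¹
    have hmr : ((m : ℝ≥0) + 1)⁻¹ < r₀ := by
      rw [inv_lt_comm₀ (by positivity) hr₀]
      exact hm.trans (lt_add_one _)
    obtain ⟨n, hn⟩ := mem_iUnion.1 (hQ_univ m ▸ mem_univ x)
    exact mem_iUnion₂.2 ⟨m, n, ⟨hxA, fun r hr => h ⟨hr.1, hr.2.trans_lt hmr⟩⟩, hn⟩
  refine measure_mono_null h_sub (measure_iUnion_null fun m => measure_iUnion_null fun n => ?_)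
  exact hausdorffContent_eq_zero_of_sparse_of_ediam_le ht
    (inter_subset_left.trans (sep_subset _ _))
    ((ediam_mono inter_subset_right).trans (hQ_diam m n)) fun x hx => hx.1.2

/-- The sparse points of the images under `f` of all cylinders of the Baire space. -/
def exceptionalSet (t : ℝ) (f : (ℕ → ℕ) → X) : Set X :=
  ⋃ l : List ℕ, sparsePoints t (f '' {y | PiNat.res y l.length = l})

lemma hausdorffContent_exceptionalSet (ht : 0 < t) (f : (ℕ → ℕ) → X) :
    hausdorffContent X t (exceptionalSet t f) = 0 :=
  measure_iUnion_null fun _ => hausdorffContent_sparsePoints ht _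

end Content

section Node

/-- A vertex of the trees constructed below: a centre, given by a parameter in the Baire space, and
a scale. -/
structure Node where
  seq : ℕ → ℕ
  rad : ℝ≥0

variable {X : Type*} [MetricSpace X] {t : ℝ} {f : (ℕ → ℕ) → X}

/-- The part of `f '' cylinder n.seq k` within distance `n.rad` of the centre, without the
exceptional set. -/
def nodePiece (t : ℝ) (f : (ℕ → ℕ) → X) (k : ℕ) (n : Node) : Set X :=
  (f '' PiNat.cylinder n.seq k ∩ closedBall (f n.seq) n.rad) \ exceptionalSet t f

/-- The piece of the node of level `k` has large content at the scale of the node. -/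
structure IsGoodNode (t : ℝ) (f : (ℕ → ℕ) → X) (k : ℕ) (n : Node) : Prop where
  rad_pos : 0 < n.rad
  lt_content : (n.rad : ℝ≥0∞) ^ t / 2 < hausdorffContent X t (nodePiece t f k n)

lemma exists_isGoodNode [SeparableSpace X] (ht : 0 < t) (k : ℕ) {z : ℕ → ℕ}
    (hz : f z ∉ exceptionalSet t f) {r₀ : ℝ≥0} (hr₀ : 0 < r₀) :
    ∃ r ≤ r₀, IsGoodNode t f k ⟨z, r⟩ := by
  have h_cyl : {y | PiNat.res y (PiNat.res z k).length = PiNat.res z k} = PiNat.cylinder z k := by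
    rw [PiNat.cylinder_eq_res, PiNat.res_length]
  have h_not_sparse : f z ∉ sparsePoints t (f '' PiNat.cylinder z k) := fun h =>
    hz (mem_iUnion.2 ⟨PiNat.res z k, by rwa [h_cyl]⟩)
  have h_freq : ∃ᶠ r : ℝ≥0 in 𝓝[>] 0,
      (r : ℝ≥0∞) ^ t / 2 < hausdorffContent X t (f '' PiNat.cylinder z k ∩ closedBall (f z) r) := by
    intro h
    exact h_not_sparse ⟨mem_image_of_mem f (PiNat.self_mem_cylinder z k),
      h.mono fun r hr => not_lt.1 hr⟩
  obtain ⟨r, hr, hr_mem⟩ := (h_freq.and_eventually (Ioc_mem_nhdsGT hr₀)).exists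
  refine ⟨r, hr_mem.2, hr_mem.1, hr.trans_le ?_⟩
  calc hausdorffContent X t (f '' PiNat.cylinder z k ∩ closedBall (f z) r)
      ≤ hausdorffContent X t (nodePiece t f k ⟨z, r⟩ ∪ exceptionalSet t f) :=
        measure_mono (by rw [nodePiece, sdiff_union_self]; exact subset_union_left)
    _ ≤ hausdorffContent X t (nodePiece t f k ⟨z, r⟩) + hausdorffContent X t (exceptionalSet t f) :=
        measure_union_le _ _
    _ = hausdorffContent X t (nodePiece t f k ⟨z, r⟩) := by
        rw [hausdorffContent_exceptionalSet ht, add_zero]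

end Node

section Weight

variable {ι : Type*}

lemma exists_maximal_weight (g : Finset ι → ℝ≥0∞) :
    ∃ ν : ι → ℝ≥0∞, Maximal (fun ν => ∀ S, ∑ i ∈ S, ν i ≤ g S) ν := by
  refine zorn_le₀ {ν : ι → ℝ≥0∞ | ∀ S, ∑ i ∈ S, ν i ≤ g S} fun c hc h_chain => ?_
  refine ⟨⨆ ν : c, (ν : ι → ℝ≥0∞), fun S => ?_, fun ν hν => le_iSup_of_le ⟨ν, hν⟩ le_rfl⟩
  have h_directed (μ ν : c) : ∃ θ : c, ∀ i, (μ : ι → ℝ≥0∞) i ≤ (θ : ι → ℝ≥0∞) i ∧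
      (ν : ι → ℝ≥0∞) i ≤ (θ : ι → ℝ≥0∞) i := by
    obtain h | h := h_chain.total μ.2 ν.2
    exacts [⟨ν, fun i => ⟨h i, le_rfl⟩⟩, ⟨μ, fun i => ⟨le_rfl, h i⟩⟩]
  simp only [iSup_apply]
  rw [ENNReal.finsetSum_iSup (f := fun i (ν : c) => (ν : ι → ℝ≥0∞) i) h_directed]
  exact iSup_le fun ν => hc ν.2 S

/-- A maximal weight below `g` cannot be increased at `i`, so it almost attains `g` on some finite
set containing `i`. -/
lemma exists_almost_saturated_weight (g : Finset ι → ℝ≥0∞) (hg : ∀ i, g {i} ≠ ∞) :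
    ∃ ν : ι → ℝ≥0∞, (∀ S, ∑ i ∈ S, ν i ≤ g S) ∧
      ∀ i, ∀ ε ≠ 0, ∃ S, i ∈ S ∧ g S < ∑ j ∈ S, ν j + ε := by
  classical
  obtain ⟨ν, hν⟩ := exists_maximal_weight g
  refine ⟨ν, hν.prop, fun i ε hε => ?_⟩
  by_contra! h
  have h_update : ∀ S, ∑ j ∈ S, Function.update ν i (ν i + ε) j ≤ g S := fun S => by
    by_cases hi : i ∈ S
    · rw [Finset.sum_update_of_mem hi, add_right_comm, ← Finset.erase_eq,
        Finset.add_sum_erase S ν hi]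
      exact h S hi
    · rw [Finset.sum_update_of_notMem hi]
      exact hν.prop S
  have h_le : Function.update ν i (ν i + ε) i ≤ ν i :=
    hν.le_of_ge h_update (le_update_self_iff.2 le_self_add) i
  have h_ne_top : ν i ≠ ∞ := ne_top_of_le_ne_top (hg i) (by simpa using hν.prop {i})
  rw [Function.update_self] at h_le
  exact (ENNReal.lt_add_right h_ne_top hε).not_ge h_le

variable {X : Type*} [EMetricSpace X]

/-- The size of the family of balls with centres `y i` and radii `ρ i`, `i ∈ B`: the diameter of the
set of centres plus the largest radius. -/
def familySize (y : ι → X) (ρ : ι → ℝ≥0) (B : Set ι) : ℝ≥0∞ :=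
  ediam (y '' B) + ⨆ i ∈ B, (ρ i : ℝ≥0∞)

variable {y : ι → X} {ρ : ι → ℝ≥0} {B : Set ι} {i j : ι} {t : ℝ}

lemma familySize_mono (y : ι → X) (ρ : ι → ℝ≥0) : Monotone (familySize y ρ) := fun _ _ h =>
  add_le_add (ediam_mono (image_mono h)) (biSup_mono fun _ hi => h hi)

lemma familySize_singleton (y : ι → X) (ρ : ι → ℝ≥0) (i : ι) : familySize y ρ {i} = ρ i := by
  simp [familySize]

lemma coe_le_familySize (hi : i ∈ B) : ρ i ≤ familySize y ρ B :=
  (le_iSup₂ (f := fun i (_ : i ∈ B) => (ρ i : ℝ≥0∞)) i hi).trans le_add_self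

lemma edist_le_familySize (hi : i ∈ B) (hj : j ∈ B) : edist (y i) (y j) ≤ familySize y ρ B :=
  (edist_le_ediam_of_mem (mem_image_of_mem y hi) (mem_image_of_mem y hj)).trans le_self_add

lemma exists_tight_weight (ht : 0 < t) (y : ι → X) (hρ : ∀ i, 0 < ρ i) :
    ∃ ν : ι → ℝ≥0∞, (∀ B : Set ι, ∑' i : B, ν i ≤ familySize y ρ B ^ t) ∧
      ∀ i, ∃ S : Finset ι, i ∈ S ∧ familySize y ρ S ^ t ≤ 2 * ∑ j ∈ S, ν j := by
  have h_mono : Monotone fun B => familySize y ρ B ^ t := fun _ _ h =>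
    ENNReal.rpow_le_rpow (familySize_mono y ρ h) ht.le
  obtain ⟨ν, hν_le, hν_sat⟩ := exists_almost_saturated_weight
    (fun S : Finset ι => familySize y ρ S ^ t) fun i => by
      simpa [familySize_singleton] using ENNReal.rpow_ne_top_of_nonneg ht.le ENNReal.coe_ne_top
  refine ⟨ν, fun B => ?_, fun i => ?_⟩
  · rw [ENNReal.tsum_eq_iSup_sum]
    refine iSup_le fun S => ?_
    rw [← Function.Embedding.coe_subtype, ← Finset.sum_map]
    refine (hν_le _).trans (h_mono fun i hi => ?_)
    obtain ⟨b, -, rfl⟩ := Finset.mem_map.1 hi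
    exact b.2
  have h_ne : familySize y ρ {i} ^ t / 2 ≠ 0 := by
    simp [familySize_singleton, (hρ i).ne']
  obtain ⟨S, hiS, hS⟩ := hν_sat i _ h_ne
  refine ⟨S, hiS, ?_⟩
  have h_half : familySize y ρ S ^ t / 2 < ∑ j ∈ S, ν j := by
    refine lt_of_add_lt_add_right (a := familySize y ρ S ^ t / 2) ?_
    calc familySize y ρ S ^ t / 2 + familySize y ρ S ^ t / 2
        = familySize y ρ S ^ t := ENNReal.add_halves _
      _ < ∑ j ∈ S, ν j + familySize y ρ {i} ^ t / 2 := hS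
      _ ≤ ∑ j ∈ S, ν j + familySize y ρ S ^ t / 2 := by
          gcongr
          exact familySize_mono y ρ (singleton_subset_iff.2 hiS)
  calc familySize y ρ S ^ t = 2 * (familySize y ρ S ^ t / 2) :=
        (ENNReal.mul_div_cancel two_ne_zero ENNReal.ofNat_ne_top).symm
    _ ≤ 2 * ∑ j ∈ S, ν j := by gcongr

lemma hausdorffContent_closedEBall_le (ht : 0 ≤ t) (x : X) (c h : ℝ≥0∞) :
    hausdorffContent X t (closedEBall x (c * h)) ≤ (2 * c) ^ t * h ^ t := by
  rw [← ENNReal.mul_rpow_of_nonneg _ _ ht, mul_assoc]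
  exact (hausdorffContent_le t _).trans (ENNReal.rpow_le_rpow ediam_closedEBall_le ht)

/-- Frostman's lemma for a family of balls: by the Vitali covering lemma, the tight sets contain
disjoint ones whose enlargements cover `A`. -/
lemma exists_frostman_weight [Countable ι] (ht : 0 < t) (y : ι → X) (hρ : ∀ i, 0 < ρ i)
    (h_size : familySize y ρ univ ≠ ∞) {A : Set X} (hA : A ⊆ ⋃ i, closedEBall (y i) (15 * ρ i)) :
    ∃ ν : ι → ℝ≥0∞, (∀ B : Set ι, ∑' i : B, ν i ≤ familySize y ρ B ^ t) ∧
      hausdorffContent X t A ≤ 2 * 66 ^ t * ∑' i, ν i := by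
  obtain ⟨ν, hν_le, hν_tight⟩ := exists_tight_weight ht y hρ
  choose S hS_mem hS using hν_tight
  refine ⟨ν, hν_le, ?_⟩
  let h (i : ι) : ℝ≥0∞ := familySize y ρ (S i)
  have h_ne_top (i : ι) : h i ≠ ∞ :=
    ne_top_of_le_ne_top h_size (familySize_mono y ρ (subset_univ _))
  obtain ⟨v, -, hv_disj, hv⟩ := Vitali.exists_disjoint_subfamily_covering_enlargement
    (fun i => (S i : Set ι)) univ (fun i => (h i).toReal) 2 one_lt_two
    (fun _ _ => ENNReal.toReal_nonneg) (familySize y ρ univ).toReal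
    (fun _ _ => ENNReal.toReal_mono h_size (familySize_mono y ρ (subset_univ _)))
    fun i _ => ⟨i, hS_mem i⟩
  have h_cover : A ⊆ ⋃ b ∈ v, closedEBall (y b) (33 * h b) := fun x hx => by
    obtain ⟨i, hi⟩ := mem_iUnion.1 (hA hx)
    obtain ⟨b, hbv, ⟨j, hj_i, hj_b⟩, hle⟩ := hv i (mem_univ i)
    have hib : h i ≤ 2 * h b := by
      rw [← ENNReal.toReal_le_toReal (h_ne_top i) (ENNReal.mul_ne_top (by simp) (h_ne_top b))]
      simpa using hle
    refine mem_iUnion₂.2 ⟨b, hbv, ?_⟩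
    calc edist x (y b) ≤ edist x (y i) + edist (y i) (y j) + edist (y j) (y b) :=
          edist_triangle4 _ _ _ _
      _ ≤ 15 * h i + h i + h b := by
          gcongr
          · exact (mem_closedEBall.1 hi).trans (by gcongr; exact coe_le_familySize (hS_mem i))
          · exact edist_le_familySize (hS_mem i) hj_i
          · exact edist_le_familySize hj_b (hS_mem b)
      _ ≤ 15 * (2 * h b) + 2 * h b + h b := by gcongr
      _ = 33 * h b := by ring
  calc hausdorffContent X t A
      ≤ ∑' b : v, hausdorffContent X t (closedEBall (y b) (33 * h b)) :=
        (measure_mono h_cover).trans (measure_biUnion_le _ v.to_countable _)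
    _ ≤ ∑' b : v, 2 * 66 ^ t * ∑' i : (S b : Set ι), ν i := by
        refine ENNReal.tsum_le_tsum fun b => ?_
        refine (hausdorffContent_closedEBall_le ht.le _ _ _).trans ?_
        rw [show (2 * 33 : ℝ≥0∞) = 66 by norm_num, mul_comm 2, mul_assoc,
          Finset.tsum_subtype' (S b) ν]
        gcongr
        exact hS b
    _ = 2 * 66 ^ t * ∑' i : ⋃ b ∈ v, (S b : Set ι), ν i := by
        rw [ENNReal.tsum_mul_left, ENNReal.tsum_biUnion' hv_disj]
    _ ≤ 2 * 66 ^ t * ∑' i, ν i := by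
        gcongr
        exact ENNReal.tsum_comp_le_tsum_of_injective Subtype.val_injective ν

end Weight

section ChildLaw

lemma familySize_le_three_mul {ι X : Type*} [EMetricSpace X] {y : ι → X} {ρ : ι → ℝ≥0} {B : Set ι}
    {x : X} {M : ℝ≥0∞} (hy : ∀ i ∈ B, edist (y i) x ≤ M) (hρ : ∀ i ∈ B, ρ i ≤ M) :
    familySize y ρ B ≤ 3 * M := by
  have h_diam : ediam (y '' B) ≤ 2 * M :=
    (ediam_mono (image_subset_iff.2 hy : y '' B ⊆ closedEBall x M)).trans ediam_closedEBall_le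
  calc familySize y ρ B ≤ 2 * M + M := add_le_add h_diam (iSup₂_le hρ)
    _ = 3 * M := by ring

variable {X : Type*} [MetricSpace X] {s t : ℝ} {f : (ℕ → ℕ) → X}

lemma exists_pmf_le_familySize {ι : Type*} [Countable ι] (ht : 0 < t) {y : ι → X} {ρ : ι → ℝ≥0}
    (hρ : ∀ i, 0 < ρ i) (h_size : familySize y ρ univ ≠ ∞) {A : Set X}
    (hA : A ⊆ ⋃ i, closedEBall (y i) (15 * ρ i)) {r : ℝ≥0} (hr : 0 < r)
    (h_content : (r : ℝ≥0∞) ^ t / 2 < hausdorffContent X t A) :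
    ∃ p : PMF ι, ∀ B, p.toOuterMeasure B ≤ 4 * 66 ^ t * (familySize y ρ B / r) ^ t := by
  obtain ⟨ν, hν, hA_le⟩ := exists_frostman_weight ht y hρ h_size hA
  have h_zero : ∑' i, ν i ≠ 0 := fun h => by
    rw [h, mul_zero] at hA_le
    exact (h_content.trans_le hA_le).not_ge zero_le
  have h_top : ∑' i, ν i ≠ ∞ := by
    rw [← tsum_univ]
    exact ne_top_of_le_ne_top (ENNReal.rpow_ne_top_of_nonneg ht.le h_size) (hν univ)
  have hrt : (r : ℝ≥0∞) ^ t ≤ 4 * 66 ^ t * ∑' i, ν i := by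
    have := h_content.le.trans hA_le
    rw [ENNReal.div_le_iff (by simp) (by simp)] at this
    exact this.trans_eq (by ring)
  refine ⟨PMF.normalize ν h_zero h_top, fun B => ?_⟩
  calc (PMF.normalize ν h_zero h_top).toOuterMeasure B
      = (∑' i : B, ν i) / ∑' i, ν i := by
        rw [PMF.toOuterMeasure_apply, ← tsum_subtype, div_eq_mul_inv, ← ENNReal.tsum_mul_right]
        rfl
    _ ≤ familySize y ρ B ^ t / ∑' i, ν i := by gcongr; exact hν B
    _ ≤ 4 * 66 ^ t * (familySize y ρ B / r) ^ t := by
        rw [ENNReal.div_le_iff h_zero h_top, ENNReal.div_rpow_of_nonneg _ _ ht.le]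
        calc familySize y ρ B ^ t = familySize y ρ B ^ t / r ^ t * r ^ t :=
              (ENNReal.div_mul_cancel (by simp [hr.ne']) (by simp [ht.le])).symm
          _ ≤ familySize y ρ B ^ t / r ^ t * (4 * 66 ^ t * ∑' i, ν i) := by gcongr
          _ = 4 * 66 ^ t * (familySize y ρ B ^ t / r ^ t) * ∑' i, ν i := by ring

lemma exists_separated_cover [SeparableSpace X] {A : Set X} {ρ : X → ℝ≥0} {R : ℝ≥0}
    (hρ_pos : ∀ x ∈ A, 0 < ρ x) (hρ_le : ∀ x ∈ A, ρ x ≤ R) :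
    ∃ u ⊆ A, u.Countable ∧ (∀ x ∈ u, ∀ y ∈ u, x ≠ y → 3 * (ρ x : ℝ) ≤ dist x y) ∧
      A ⊆ ⋃ x : u, closedEBall (x : X) (15 * ρ x) := by
  have h_pos (x) (hx : x ∈ A) : (0 : ℝ) < 3 * ρ x := mul_pos three_pos (hρ_pos x hx)
  obtain ⟨u, huA, hu_disj, hu⟩ := Vitali.exists_disjoint_subfamily_covering_enlargement_closedBall
    A id (fun x => 3 * (ρ x : ℝ)) (3 * R) (fun x hx => by have := hρ_le x hx; gcongr) 5
    (by norm_num)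
  refine ⟨u, huA, hu_disj.countable_of_nonempty_interior fun x hx =>
    ⟨x, ball_subset_interior_closedBall (mem_ball_self (h_pos x (huA hx)))⟩, ?_, fun x hx => ?_⟩
  · intro x hx y hy hxy
    by_contra! hlt
    refine disjoint_left.1 (hu_disj hx hy hxy) (?_ : y ∈ closedBall x (3 * ρ x)) ?_
    · exact mem_closedBall'.2 hlt.le
    · exact mem_closedBall_self (h_pos y (huA hy)).le
  · obtain ⟨b, hb, h_sub⟩ := hu x hx
    have hxb : dist x b ≤ 5 * (3 * ρ b) := h_sub (mem_closedBall_self (h_pos x hx).le)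
    refine mem_iUnion.2 ⟨⟨b, hb⟩, ?_⟩
    rw [mem_closedEBall, edist_nndist]
    have : nndist x b ≤ 15 * ρ b := by
      rw [← NNReal.coe_le_coe]
      push_cast
      linarith
    exact_mod_cast this

lemma exists_pos_le_mul_rpow_le_half {K : ℝ≥0∞} (hK : K ≠ ∞) {a : ℝ} (ha : 0 < a) {b : ℝ≥0}
    (hb : 0 < b) : ∃ θ : ℝ≥0, 0 < θ ∧ θ ≤ b ∧ K * (θ : ℝ≥0∞) ^ a ≤ 2⁻¹ := by
  have h_lim : Tendsto (fun θ : ℝ≥0 => K * (θ : ℝ≥0∞) ^ a) (𝓝[>] 0) (𝓝 0) := by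
    have h_coe : Tendsto (fun θ : ℝ≥0 => (θ : ℝ≥0∞)) (𝓝[>] 0) (𝓝 0) :=
      (ENNReal.tendsto_coe.2 tendsto_id).mono_left nhdsWithin_le_nhds
    simpa [ha] using ENNReal.Tendsto.const_mul (h_coe.ennrpow_const a) (.inr hK)
  obtain ⟨θ, hθ_half, hθ⟩ := ((h_lim.eventually_le_const (by simp : (0 : ℝ≥0∞) < 2⁻¹)).and
    (Ioc_mem_nhdsGT hb)).exists
  exact ⟨θ, hθ.1, hθ.2, hθ_half⟩

lemma le_mul_rpow_of_le_mul_rpow_of_le_one {a x K : ℝ≥0∞} (hs : 0 ≤ s) (hst : s ≤ t) (hK : 1 ≤ K)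
    (ha : a ≤ 1) (h : a ≤ K * x ^ t) : a ≤ K * x ^ s := by
  rcases le_total x 1 with hx | hx
  · exact h.trans (mul_le_mul_right (ENNReal.rpow_le_rpow_of_exponent_ge hx hst) K)
  · calc a ≤ 1 * 1 ^ s := by simpa using ha
      _ ≤ K * x ^ s := by gcongr

/-- A law `p` for the children `c i` of the node `n` of level `k` which is at most
`s`-dimensional at the scale of `n`. Children outside the support of `p` need not be separated. -/
structure IsChildLaw {ι : Type*} (f : (ℕ → ℕ) → X) (s : ℝ) (K : ℝ≥0∞) (k : ℕ) (n : Node)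
    (p : PMF ι) (c : ι → Node) : Prop where
  seq_mem_cylinder : ∀ i, (c i).seq ∈ PiNat.cylinder n.seq k
  dist_le : ∀ i, dist (f (c i).seq) (f n.seq) ≤ n.rad
  rad_le : ∀ i, 5 * (c i).rad ≤ n.rad
  separated : ∀ i ∈ p.support, ∀ j ∈ p.support, i ≠ j →
    3 * ((c i).rad : ℝ) ≤ dist (f (c i).seq) (f (c j).seq)
  apply_le : ∀ i ∈ p.support, p i ≤ ((c i).rad / n.rad : ℝ≥0∞) ^ s / 2
  toOuterMeasure_le : ∀ i ∈ p.support, ∀ ρ : ℝ≥0,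
    p.toOuterMeasure {j ∈ p.support | j ≠ i ∧ dist (f (c i).seq) (f (c j).seq) ≤ ρ} ≤
      K * (ρ / n.rad) ^ s

lemma IsChildLaw.exists_nat {ι : Type*} [Countable ι] {K : ℝ≥0∞} {k : ℕ} {n : Node} {p : PMF ι}
    {c : ι → Node} (h : IsChildLaw f s K k n p c) :
    ∃ (q : PMF ℕ) (e : ℕ → ι), IsChildLaw f s K k n q (c ∘ e) := by
  have : Nonempty ι := p.support_nonempty.to_type
  obtain ⟨e, he⟩ := exists_injective_nat ι
  have h_inv : ∀ i, Function.invFun e (e i) = i := Function.leftInverse_invFun he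
  have h_map (B : Set ℕ) : (p.map e).toOuterMeasure B = p.toOuterMeasure (e ⁻¹' B) :=
    PMF.toOuterMeasure_map_apply e p B
  refine ⟨p.map e, Function.invFun e, fun j => h.seq_mem_cylinder _, fun j => h.dist_le _,
    fun j => h.rad_le _, ?_, ?_, ?_⟩ <;>
    simp only [PMF.support_map, forall_mem_image, Function.comp_apply, h_inv, he.ne_iff]
  · exact h.separated
  · intro i hi
    rw [← PMF.toOuterMeasure_apply_singleton, h_map, ← image_singleton, he.preimage_image,
      PMF.toOuterMeasure_apply_singleton]
    exact h.apply_le i hi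
  · intro i hi ρ
    rw [h_map]
    refine le_trans (measure_mono ?_) (h.toOuterMeasure_le i hi ρ)
    rintro j ⟨⟨j', hj', hjj'⟩, hne, hdist⟩
    obtain rfl := he hjj'
    exact ⟨hj', fun hji => hne (hji ▸ rfl), by simpa only [Function.comp_apply, h_inv] using hdist⟩

lemma isChildLaw_of_le_familySize {ι : Type*} {K : ℝ≥0∞} {θ : ℝ≥0} {k : ℕ} {n : Node} {p : PMF ι}
    {c : ι → Node} (hs : 0 ≤ s) (hst : s < t) (hK : 1 ≤ K) (hθ : 5 * θ ≤ 1)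
    (hKθ : K * (θ : ℝ≥0∞) ^ (t - s) ≤ 2⁻¹) (h_seq : ∀ i, (c i).seq ∈ PiNat.cylinder n.seq k)
    (h_dist : ∀ i, dist (f (c i).seq) (f n.seq) ≤ n.rad) (h_rad : ∀ i, (c i).rad ≤ θ * n.rad)
    (h_sep : ∀ i j, i ≠ j → 3 * ((c i).rad : ℝ) ≤ dist (f (c i).seq) (f (c j).seq))
    (hp : ∀ B, p.toOuterMeasure B ≤
      K * (familySize (fun i => f (c i).seq) (fun i => (c i).rad) B / n.rad) ^ t) :
    IsChildLaw f s (K * 3 ^ t) k n p c where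
  seq_mem_cylinder := h_seq
  dist_le := h_dist
  rad_le i := calc
    5 * (c i).rad ≤ 5 * (θ * n.rad) := by gcongr; exact h_rad i
    _ = 5 * θ * n.rad := by ring
    _ ≤ n.rad := mul_le_of_le_one_left zero_le hθ
  separated i _ j _ := h_sep i j
  apply_le i _ := by
    have h_ratio : ((c i).rad / n.rad : ℝ≥0∞) ≤ θ :=
      ENNReal.div_le_of_le_mul (by exact_mod_cast h_rad i)
    calc p i ≤ K * ((c i).rad / n.rad : ℝ≥0∞) ^ t := by
          simpa only [PMF.toOuterMeasure_apply_singleton, familySize_singleton] using hp {i}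
      _ = K * ((c i).rad / n.rad : ℝ≥0∞) ^ (t - s) * ((c i).rad / n.rad : ℝ≥0∞) ^ s := by
          rw [mul_assoc, ← ENNReal.rpow_add_of_nonneg _ _ (sub_pos.2 hst).le hs, sub_add_cancel]
      _ ≤ 2⁻¹ * ((c i).rad / n.rad : ℝ≥0∞) ^ s := by
          gcongr
          exact le_trans (by gcongr) hKθ
      _ = ((c i).rad / n.rad : ℝ≥0∞) ^ s / 2 := ENNReal.div_eq_inv_mul.symm
  toOuterMeasure_le i _ ρ := by
    have ht : 0 ≤ t := hs.trans hst.le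
    have h3 : (1 : ℝ≥0∞) ≤ 3 ^ t := by
      simpa using ENNReal.rpow_le_rpow (by norm_num : (1 : ℝ≥0∞) ≤ 3) ht
    refine le_mul_rpow_of_le_mul_rpow_of_le_one hs hst.le (one_le_mul hK h3)
      ((measure_mono (subset_univ _)).trans
        ((p.toOuterMeasure_apply_eq_one_iff _).2 (subset_univ _)).le) ((hp _).trans ?_)
    rw [mul_assoc, ← ENNReal.mul_rpow_of_nonneg _ _ ht, ← mul_div_assoc]
    gcongr
    refine familySize_le_three_mul (x := f (c i).seq) (fun j hj => ?_) fun j hj => ?_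
    · rw [edist_comm, edist_le_coe]
      exact hj.2.2
    · have h_rad_le : 3 * ((c j).rad : ℝ) ≤ ρ :=
        (h_sep j i hj.2.1).trans ((dist_comm _ _).trans_le hj.2.2)
      rw [ENNReal.coe_le_coe, ← NNReal.coe_le_coe]
      linarith [(c j).rad.coe_nonneg]

lemma exists_child [SeparableSpace X] (ht : 0 < t) {k : ℕ} {n : Node} {r : ℝ≥0} (hr : 0 < r) {x : X}
    (hx : x ∈ nodePiece t f k n) :
    ∃ a : Node, a.seq ∈ PiNat.cylinder n.seq k ∧ f a.seq = x ∧ a.rad ≤ r ∧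
      IsGoodNode t f (k + 1) a := by
  obtain ⟨⟨⟨z, hz, rfl⟩, -⟩, h_not_mem⟩ := hx
  obtain ⟨ρ, hρ, h_good⟩ := exists_isGoodNode ht (k + 1) h_not_mem hr
  exact ⟨⟨z, ρ⟩, hz, rfl, hρ, h_good⟩

lemma exists_isChildLaw [SeparableSpace X] (f : (ℕ → ℕ) → X) (hs : 0 ≤ s) (hst : s < t) :
    ∃ K ≠ ∞, ∀ k n, IsGoodNode t f k n → ∃ (p : PMF ℕ) (c : ℕ → Node),
      IsChildLaw f s K k n p c ∧ ∀ j, IsGoodNode t f (k + 1) (c j) := by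
  have ht : 0 < t := hs.trans_lt hst
  have h_pow_ne_top {a : ℝ≥0∞} (ha : a ≠ ∞) : a ^ t ≠ ∞ := ENNReal.rpow_ne_top_of_nonneg ht.le ha
  have hK : (4 * 66 ^ t : ℝ≥0∞) ≠ ∞ := ENNReal.mul_ne_top (by simp) (h_pow_ne_top (by simp))
  have hK_one : (1 : ℝ≥0∞) ≤ 4 * 66 ^ t :=
    one_le_mul (by norm_num)
      (by simpa using ENNReal.rpow_le_rpow (by norm_num : (1 : ℝ≥0∞) ≤ 66) ht.le)
  obtain ⟨θ, hθ_pos, hθ, hKθ⟩ :=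
    exists_pos_le_mul_rpow_le_half hK (sub_pos.2 hst) (by norm_num : (0 : ℝ≥0) < 5⁻¹)
  have hθ5 : 5 * θ ≤ 1 := (mul_le_mul_right hθ 5).trans_eq (mul_inv_cancel₀ (by norm_num))
  refine ⟨4 * 66 ^ t * 3 ^ t, ENNReal.mul_ne_top hK (h_pow_ne_top (by simp)), fun k n hn => ?_⟩
  have : Nonempty Node := ⟨n⟩
  choose! c hc_seq hc_eq hc_rad hc_good using fun x (hx : x ∈ nodePiece t f k n) =>
    exists_child ht (mul_pos hθ_pos hn.rad_pos) hx
  obtain ⟨u, hu, hu_countable, hu_sep, hu_cover⟩ := exists_separated_cover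
    (ρ := fun x => (c x).rad) (fun x hx => (hc_good x hx).rad_pos) hc_rad
  have : Countable u := hu_countable
  have h_eq (x : u) : f (c x).seq = x := hc_eq x (hu x.2)
  have h_dist (x : u) : dist (x : X) (f n.seq) ≤ n.rad := (hu x.2).1.2
  have h_rad (x : u) : (c x).rad ≤ θ * n.rad := hc_rad x (hu x.2)
  have h_size : familySize (fun x : u => (x : X)) (fun x => (c x).rad) univ ≠ ∞ := by
    refine ne_top_of_le_ne_top (ENNReal.mul_ne_top (by simp) ENNReal.coe_ne_top)
      (familySize_le_three_mul (x := f n.seq) (M := n.rad)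
        (fun x _ => edist_le_coe.2 (h_dist x)) fun x _ => ?_)
    have : θ ≤ 1 := le_trans (le_mul_of_one_le_left' (by norm_num)) hθ5
    exact_mod_cast (h_rad x).trans (mul_le_of_le_one_left zero_le this)
  obtain ⟨p, hp⟩ := exists_pmf_le_familySize ht (fun x : u => (hc_good x (hu x.2)).rad_pos) h_size
    hu_cover hn.rad_pos hn.lt_content
  have h_law : IsChildLaw f s (4 * 66 ^ t * 3 ^ t) k n p fun x : u => c x :=
    isChildLaw_of_le_familySize hs hst hK_one hθ5 hKθ (fun x => hc_seq x (hu x.2))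
      (fun x => by simpa only [h_eq] using h_dist x) h_rad
      (fun x y hxy => by
        simpa only [h_eq] using hu_sep x x.2 y y.2 (Subtype.coe_ne_coe.2 hxy))
      (by simpa only [h_eq] using hp)
  obtain ⟨q, e, hq⟩ := h_law.exists_nat
  exact ⟨q, _, hq, fun j => hc_good _ (hu (e j).2)⟩

end ChildLaw

section RandomPath

/-- The first `k` letters, in the order of `PiNat.res`, of the path which continues every word `l`
by the letter `ξ l`. -/
def choicePrefix (ξ : List ℕ → ℕ) : ℕ → List ℕ
  | 0 => []
  | k + 1 => ξ (choicePrefix ξ k) :: choicePrefix ξ k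

/-- The path which continues every word `l` by the letter `ξ l`. -/
def choicePath (ξ : List ℕ → ℕ) (k : ℕ) : ℕ := ξ (choicePrefix ξ k)

lemma res_choicePath (ξ : List ℕ → ℕ) (k : ℕ) : PiNat.res (choicePath ξ) k = choicePrefix ξ k := by
  induction k with
  | zero => rfl
  | succ k ih => rw [PiNat.res_succ, ih]; rfl

lemma choicePath_apply_of_mem_cylinder {ξ : List ℕ → ℕ} {z : ℕ → ℕ} {k : ℕ}
    (h : choicePath ξ ∈ PiNat.cylinder z k) : choicePath ξ k = ξ (PiNat.res z k) := by
  rw [← mem_ofPred.1 ((PiNat.cylinder_eq_res z k).subset h), res_choicePath]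
  rfl

lemma choicePath_mem_cylinder_iff {ξ : List ℕ → ℕ} {z : ℕ → ℕ} {k : ℕ} :
    choicePath ξ ∈ PiNat.cylinder z k ↔ ∀ i < k, ξ (PiNat.res z i) = z i := by
  induction k with
  | zero => simp
  | succ k ih =>
    rw [Nat.forall_lt_succ_right, ← ih, PiNat.mem_cylinder_iff, Nat.forall_lt_succ_right,
      ← PiNat.mem_cylinder_iff]
    exact and_congr_right fun h => by rw [choicePath_apply_of_mem_cylinder h]

lemma measurableSet_choicePrefix_eq (k : ℕ) (l : List ℕ) :
    MeasurableSet {ξ | choicePrefix ξ k = l} := by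
  induction k generalizing l with
  | zero => simp [choicePrefix]
  | succ k ih =>
    cases l with
    | nil => simp [choicePrefix]
    | cons a l =>
      have h_eq : {ξ | choicePrefix ξ (k + 1) = a :: l} =
          {ξ | choicePrefix ξ k = l} ∩ (fun ξ => ξ l) ⁻¹' {a} := by
        ext ξ
        simp only [choicePrefix, List.cons.injEq, mem_ofPred_eq, mem_inter_iff, mem_preimage,
          mem_singleton_iff]
        grind
      rw [h_eq]
      exact (ih l).inter (measurable_pi_apply l (measurableSet_singleton a))

lemma measurable_choicePath : Measurable choicePath := by
  refine measurable_pi_iff.2 fun k => measurable_to_countable' fun a => ?_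
  have h_eq : (fun ξ => choicePath ξ k) ⁻¹' {a} =
      ⋃ l, {ξ | choicePrefix ξ k = l} ∩ (fun ξ => ξ l) ⁻¹' {a} := by
    ext ξ
    simp [choicePath]
  rw [h_eq]
  exact MeasurableSet.iUnion fun l =>
    (measurableSet_choicePrefix_eq k l).inter (measurable_pi_apply l (measurableSet_singleton a))

/-- The law of a random path whose next letter after the word `l` has law `w l`. -/
def pathLaw (w : List ℕ → PMF ℕ) : Measure (ℕ → ℕ) :=
  (Measure.infinitePi fun l => (w l).toMeasure).map choicePath

instance (w : List ℕ → PMF ℕ) : IsProbabilityMeasure (pathLaw w) :=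
  Measure.isProbabilityMeasure_map measurable_choicePath.aemeasurable

lemma measurableSet_cylinder_inter (z : ℕ → ℕ) (k : ℕ) (B : Set ℕ) :
    MeasurableSet (PiNat.cylinder z k ∩ {y | y k ∈ B}) :=
  (PiNat.isOpen_cylinder _ z k).measurableSet.inter
    (measurable_pi_apply k (MeasurableSet.of_discrete (s := B)))

variable {w : List ℕ → PMF ℕ} {z : ℕ → ℕ} {k : ℕ}

lemma pathLaw_cylinder_inter_eq_prod (B : Set ℕ) :
    pathLaw w (PiNat.cylinder z k ∩ {y | y k ∈ B}) =
      (∏ i ∈ Finset.range k, w (PiNat.res z i) (z i)) *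
        (w (PiNat.res z k)).toOuterMeasure B := by
  set S : List ℕ → Set ℕ := fun l => if l.length < k then {z l.length} else B
  have h_preimage : choicePath ⁻¹' (PiNat.cylinder z k ∩ {y | y k ∈ B}) =
      ((Finset.range (k + 1)).image (PiNat.res z) : Set (List ℕ)).pi S := by
    ext ξ
    have h_cyl : (∀ i < k, ξ (PiNat.res z i) ∈ S (PiNat.res z i)) ↔
        choicePath ξ ∈ PiNat.cylinder z k := by
      rw [choicePath_mem_cylinder_iff]
      exact forall₂_congr fun i hi => by simp [S, hi]
    simp only [Finset.coe_image, Finset.coe_range, Set.mem_pi, forall_mem_image, mem_Iio,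
      Nat.forall_lt_succ_right, h_cyl, mem_preimage, mem_inter_iff, mem_ofPred_eq]
    exact and_congr_right fun h => by simp [S, choicePath_apply_of_mem_cylinder h]
  rw [pathLaw, Measure.map_apply measurable_choicePath (measurableSet_cylinder_inter z k B),
    h_preimage, Measure.infinitePi_pi _ fun _ _ => MeasurableSet.of_discrete,
    Finset.prod_image fun i _ j _ hij => by simpa using congr_arg List.length hij,
    Finset.prod_range_succ]
  congr 1
  · refine Finset.prod_congr rfl fun i hi => ?_
    simp [S, Finset.mem_range.1 hi, PMF.toMeasure_apply_singleton]
  · simp [S, PMF.toMeasure_apply_eq_toOuterMeasure]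

lemma pathLaw_cylinder_inter (B : Set ℕ) :
    pathLaw w (PiNat.cylinder z k ∩ {y | y k ∈ B}) =
      pathLaw w (PiNat.cylinder z k) * (w (PiNat.res z k)).toOuterMeasure B := by
  have h := pathLaw_cylinder_inter_eq_prod (w := w) (z := z) (k := k) univ
  simp only [mem_univ, ofPred_true, inter_univ] at h
  rw [pathLaw_cylinder_inter_eq_prod, h,
    ((w _).toOuterMeasure_apply_eq_one_iff univ).2 (subset_univ _), mul_one]

lemma pathLaw_cylinder_succ :
    pathLaw w (PiNat.cylinder z (k + 1)) =
      pathLaw w (PiNat.cylinder z k) * w (PiNat.res z k) (z k) := by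
  rw [← PMF.toOuterMeasure_apply_singleton, ← pathLaw_cylinder_inter]
  congr 1
  ext y
  simp only [PiNat.mem_cylinder_iff, Nat.forall_lt_succ_right]
  rfl

lemma ae_pathLaw_apply_mem_support (w : List ℕ → PMF ℕ) :
    ∀ᵐ y ∂pathLaw w, ∀ k, y k ∈ (w (PiNat.res y k)).support := by
  refine ae_all_iff.2 fun k => measure_null_of_locally_null _ fun z _ => ?_
  refine ⟨PiNat.cylinder z k ∩ {y | y k ∈ (w (PiNat.res z k)).supportᶜ}, ?_, ?_⟩
  · filter_upwards [nhdsWithin_le_nhds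
      ((PiNat.isOpen_cylinder _ z k).mem_nhds (PiNat.self_mem_cylinder z k)),
      self_mem_nhdsWithin] with y hy h_not_mem
    have h_res : PiNat.res y k = PiNat.res z k := (PiNat.cylinder_eq_res z k).subset hy
    exact ⟨hy, h_res ▸ h_not_mem⟩
  · rw [pathLaw_cylinder_inter, ((w _).toOuterMeasure_apply_eq_zero_iff _).2
      disjoint_compl_right, mul_zero]

end RandomPath

section Tree

variable {X : Type*} [MetricSpace X] {f : (ℕ → ℕ) → X} {s : ℝ} {K : ℝ≥0∞}

/-- A tree of nodes indexed by words, latest letter first, in which every node comes with a child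
law. -/
structure FrostmanTree (f : (ℕ → ℕ) → X) (s : ℝ) (K : ℝ≥0∞) where
  node : List ℕ → Node
  law : List ℕ → PMF ℕ
  rad_pos : ∀ l, 0 < (node l).rad
  isChildLaw : ∀ l, IsChildLaw f s K l.length (node l) (law l) fun j => node (j :: l)

namespace FrostmanTree

lemma exists_of_isGoodNode [SeparableSpace X] {t : ℝ} (f : (ℕ → ℕ) → X) (hs : 0 ≤ s)
    (hst : s < t) {n : Node} (hn : IsGoodNode t f 0 n) :
    ∃ K ≠ ∞, Nonempty (FrostmanTree f s K) := by
  obtain ⟨K, hK, h_child⟩ := exists_isChildLaw f hs hst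
  choose! p c h_law h_good using h_child
  let node : List ℕ → Node := List.rec n fun j l m => c l.length m j
  have h_node_good (l : List ℕ) : IsGoodNode t f l.length (node l) := by
    induction l with
    | nil => exact hn
    | cons j l ih => exact h_good _ _ ih j
  exact ⟨K, hK, ⟨node, fun l => p l.length (node l), fun l => (h_node_good l).rad_pos,
    fun l => h_law _ _ (h_node_good l)⟩⟩

variable (T : FrostmanTree f s K)

/-- The node reached from the root after `k` steps of the path `z`. -/
def branch (z : ℕ → ℕ) (k : ℕ) : Node := T.node (PiNat.res z k)

/-- The point of Baire space on which the cylinders along the path `z` close down. -/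
def limit (z : ℕ → ℕ) (i : ℕ) : ℕ := (T.branch z (i + 1)).seq i

variable {T} {z z' : ℕ → ℕ} {k : ℕ}

lemma branch_rad_pos : 0 < (T.branch z k).rad := T.rad_pos _

lemma branch_eq_of_mem_cylinder (h : z' ∈ PiNat.cylinder z k) : T.branch z' k = T.branch z k :=
  congr_arg T.node ((PiNat.cylinder_eq_res z k).subset h)

lemma isChildLaw_branch (T : FrostmanTree f s K) (z : ℕ → ℕ) (k : ℕ) :
    IsChildLaw f s K k (T.branch z k) (T.law (PiNat.res z k))
      fun j => T.node (j :: PiNat.res z k) := by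
  simpa only [PiNat.res_length, branch] using T.isChildLaw (PiNat.res z k)

lemma branch_seq_eq_limit {i : ℕ} (h : i < k) : (T.branch z k).seq i = T.limit z i := by
  induction k, h using Nat.le_induction with
  | base => rfl
  | succ k hk ih => rw [← ih]; exact (isChildLaw_branch T z k).seq_mem_cylinder (z k) i hk

lemma tendsto_branch_seq (T : FrostmanTree f s K) (z : ℕ → ℕ) :
    Tendsto (fun k => (T.branch z k).seq) atTop (𝓝 (T.limit z)) :=
  tendsto_pi_nhds.2 fun i => tendsto_const_nhds.congr' <|
    (eventually_gt_atTop i).mono fun _ hk => (branch_seq_eq_limit hk).symm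

lemma continuous_limit (T : FrostmanTree f s K) : Continuous T.limit :=
  continuous_pi fun i => IsLocallyConstant.continuous <| IsLocallyConstant.iff_eventually_eq _ |>.2
    fun z => by
      filter_upwards [(PiNat.isOpen_cylinder _ z (i + 1)).mem_nhds (PiNat.self_mem_cylinder z _)]
        with z' hz'
      simp only [limit, branch_eq_of_mem_cylinder hz']

lemma five_mul_branch_rad_succ_le : 5 * (T.branch z (k + 1)).rad ≤ (T.branch z k).rad :=
  (isChildLaw_branch T z k).rad_le (z k)

lemma dist_branch_add_le (k m : ℕ) :
    dist (f (T.branch z (k + m)).seq) (f (T.branch z k).seq) + 5 / 4 * (T.branch z (k + m)).rad ≤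
      5 / 4 * (T.branch z k).rad := by
  induction m with
  | zero => simp
  | succ m ih =>
    have h_step : dist (f (T.branch z (k + m + 1)).seq) (f (T.branch z (k + m)).seq) ≤
        (T.branch z (k + m)).rad := (isChildLaw_branch T z (k + m)).dist_le (z (k + m))
    have h_rad : 5 * ((T.branch z (k + m + 1)).rad : ℝ) ≤ (T.branch z (k + m)).rad := by
      exact_mod_cast five_mul_branch_rad_succ_le
    rw [← add_assoc]
    linarith [dist_triangle (f (T.branch z (k + m + 1)).seq) (f (T.branch z (k + m)).seq)
      (f (T.branch z k).seq)]

lemma dist_limit_branch_le (hf : Continuous f) (z : ℕ → ℕ) (k : ℕ) :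
    dist (f (T.limit z)) (f (T.branch z k).seq) ≤ 5 / 4 * (T.branch z k).rad := by
  have h_tendsto : Tendsto (fun m => f (T.branch z (k + m)).seq) atTop (𝓝 (f (T.limit z))) :=
    (hf.tendsto _).comp ((tendsto_branch_seq T z).comp
      (tendsto_atTop_mono (Nat.le_add_left · k) tendsto_id))
  refine le_of_tendsto (h_tendsto.dist tendsto_const_nhds) (Eventually.of_forall fun m => ?_)
  linarith [dist_branch_add_le (T := T) (z := z) k m, (T.branch z (k + m)).rad.coe_nonneg]

/-- A path all of whose steps have positive probability. -/
def IsTypical (T : FrostmanTree f s K) (z : ℕ → ℕ) : Prop :=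
  ∀ k, z k ∈ (T.law (PiNat.res z k)).support

lemma ae_isTypical (T : FrostmanTree f s K) : ∀ᵐ z ∂pathLaw T.law, T.IsTypical z :=
  ae_pathLaw_apply_mem_support T.law

lemma dist_branch_succ_le_six_mul (hf : Continuous f) (hz : T.IsTypical z) (hz' : T.IsTypical z')
    (h : z' ∈ PiNat.cylinder z k) (h_ne : z' k ≠ z k) :
    dist (f (T.branch z (k + 1)).seq) (f (T.branch z' (k + 1)).seq) ≤
      6 * dist (f (T.limit z)) (f (T.limit z')) := by
  have h_res : PiNat.res z' k = PiNat.res z k := (PiNat.cylinder_eq_res z k).subset h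
  have h_mem : z' k ∈ (T.law (PiNat.res z k)).support := h_res ▸ hz' k
  have h_eq : T.branch z' (k + 1) = T.node (z' k :: PiNat.res z k) := by
    rw [branch, PiNat.res_succ, h_res]
  have h_sep : 3 * ((T.branch z (k + 1)).rad : ℝ) ≤
      dist (f (T.branch z (k + 1)).seq) (f (T.branch z' (k + 1)).seq) :=
    h_eq ▸ (isChildLaw_branch T z k).separated _ (hz k) _ h_mem h_ne.symm
  have h_sep' : 3 * ((T.branch z' (k + 1)).rad : ℝ) ≤
      dist (f (T.branch z (k + 1)).seq) (f (T.branch z' (k + 1)).seq) := by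
    rw [dist_comm, h_eq]
    exact (isChildLaw_branch T z k).separated _ h_mem _ (hz k) h_ne
  have h_center := dist_limit_branch_le (T := T) hf z (k + 1)
  have h_center' := dist_limit_branch_le (T := T) hf z' (k + 1)
  rw [dist_comm] at h_center
  linarith [dist_triangle4 (f (T.branch z (k + 1)).seq) (f (T.limit z)) (f (T.limit z'))
    (f (T.branch z' (k + 1)).seq)]

lemma pathLaw_cylinder_le (hs : 0 ≤ s) (hz : T.IsTypical z) (k : ℕ) :
    pathLaw T.law (PiNat.cylinder z k) ≤
      2⁻¹ ^ k * ((T.branch z k).rad / (T.node []).rad : ℝ≥0∞) ^ s := by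
  induction k with
  | zero =>
    rw [PiNat.cylinder_zero, measure_univ, branch, PiNat.res_zero,
      ENNReal.div_self (ENNReal.coe_ne_zero.2 (T.rad_pos _).ne') ENNReal.coe_ne_top]
    simp
  | succ k ih =>
    have h_ne : ((T.branch z k).rad : ℝ≥0∞) ≠ 0 := ENNReal.coe_ne_zero.2 branch_rad_pos.ne'
    calc pathLaw T.law (PiNat.cylinder z (k + 1))
        ≤ 2⁻¹ ^ k * ((T.branch z k).rad / (T.node []).rad : ℝ≥0∞) ^ s *
          (((T.branch z (k + 1)).rad / (T.branch z k).rad : ℝ≥0∞) ^ s / 2) := by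
          rw [pathLaw_cylinder_succ]
          exact mul_le_mul' ih ((isChildLaw_branch T z k).apply_le _ (hz k))
      _ = 2⁻¹ ^ (k + 1) * (((T.branch z k).rad / (T.node []).rad : ℝ≥0∞) *
          ((T.branch z (k + 1)).rad / (T.branch z k).rad)) ^ s := by
          rw [ENNReal.mul_rpow_of_nonneg _ _ hs, ENNReal.div_eq_inv_mul (b := 2), pow_succ]
          ring
      _ = 2⁻¹ ^ (k + 1) * ((T.branch z (k + 1)).rad / (T.node []).rad : ℝ≥0∞) ^ s := by
          congr 2
          rw [mul_comm, ← mul_div_assoc, ENNReal.div_mul_cancel h_ne ENNReal.coe_ne_top]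

lemma pathLaw_singleton (hs : 0 ≤ s) (hz : T.IsTypical z) : pathLaw T.law {z} = 0 := by
  have h_antitone : Antitone fun k => (T.branch z k).rad := antitone_nat_of_succ_le fun k =>
    (le_mul_of_one_le_left' (by norm_num)).trans five_mul_branch_rad_succ_le
  have h_pow : Tendsto (fun k => (2⁻¹ : ℝ≥0∞) ^ k) atTop (𝓝 0) :=
    ENNReal.tendsto_pow_atTop_nhds_zero_of_lt_one (by simp)
  refine nonpos_iff_eq_zero.1 (ge_of_tendsto' h_pow fun k => ?_)
  have h_ratio : ((T.branch z k).rad / (T.node []).rad : ℝ≥0∞) ≤ 1 :=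
    ENNReal.div_le_of_le_mul <| by
      rw [one_mul]
      exact ENNReal.coe_le_coe.2 (h_antitone (Nat.zero_le k))
  calc pathLaw T.law {z} ≤ pathLaw T.law (PiNat.cylinder z k) :=
        measure_mono (singleton_subset_iff.2 (PiNat.self_mem_cylinder z k))
    _ ≤ 2⁻¹ ^ k * ((T.branch z k).rad / (T.node []).rad : ℝ≥0∞) ^ s := pathLaw_cylinder_le hs hz k
    _ ≤ 2⁻¹ ^ k := mul_le_of_le_one_right' (ENNReal.rpow_le_one h_ratio hs)

/-- The paths which leave the path `z` at step `k` towards a child of positive probability within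
distance `ρ` of the child on `z`. -/
def leavingPaths (T : FrostmanTree f s K) (z : ℕ → ℕ) (k : ℕ) (ρ : ℝ≥0) : Set (ℕ → ℕ) :=
  PiNat.cylinder z k ∩ {y | y k ∈ {j ∈ (T.law (PiNat.res z k)).support | j ≠ z k ∧
    dist (f (T.branch z (k + 1)).seq) (f (T.node (j :: PiNat.res z k)).seq) ≤ ρ}}

lemma pathLaw_leavingPaths_le (hs : 0 ≤ s) (hz : T.IsTypical z) (k : ℕ) (ρ : ℝ≥0) :
    pathLaw T.law (T.leavingPaths z k ρ) ≤ 2⁻¹ ^ k * (K * (ρ / (T.node []).rad) ^ s) := by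
  have h_ne : ((T.branch z k).rad : ℝ≥0∞) ≠ 0 := ENNReal.coe_ne_zero.2 branch_rad_pos.ne'
  calc pathLaw T.law (T.leavingPaths z k ρ)
      ≤ 2⁻¹ ^ k * ((T.branch z k).rad / (T.node []).rad : ℝ≥0∞) ^ s *
        (K * (ρ / (T.branch z k).rad) ^ s) := by
        rw [leavingPaths, pathLaw_cylinder_inter]
        exact mul_le_mul' (pathLaw_cylinder_le hs hz k)
          ((isChildLaw_branch T z k).toOuterMeasure_le _ (hz k) ρ)
    _ = 2⁻¹ ^ k * (K * (ρ / (T.branch z k).rad *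
        ((T.branch z k).rad / (T.node []).rad : ℝ≥0∞)) ^ s) := by
        rw [ENNReal.mul_rpow_of_nonneg _ _ hs]
        ring
    _ = 2⁻¹ ^ k * (K * (ρ / (T.node []).rad) ^ s) := by
        rw [← mul_div_assoc, ENNReal.div_mul_cancel h_ne ENNReal.coe_ne_top]

lemma mem_leavingPaths_firstDiff (hf : Continuous f) (hz : T.IsTypical z) (hz' : T.IsTypical z')
    (h_ne : z ≠ z') {ρ : ℝ≥0} (h_dist : dist (f (T.limit z)) (f (T.limit z')) ≤ ρ) :
    z' ∈ T.leavingPaths z (PiNat.firstDiff z z') (6 * ρ) := by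
  have h_cyl : z' ∈ PiNat.cylinder z (PiNat.firstDiff z z') := by
    rw [PiNat.firstDiff_comm]
    exact PiNat.mem_cylinder_firstDiff z' z
  have h_diff := (PiNat.apply_firstDiff_ne h_ne).symm
  have h_res := (PiNat.cylinder_eq_res _ _).subset h_cyl
  refine ⟨h_cyl, h_res ▸ hz' _, h_diff, ?_⟩
  have h_le := dist_branch_succ_le_six_mul hf hz hz' h_cyl h_diff
  rw [branch, branch, PiNat.res_succ z', h_res] at h_le
  push_cast
  exact h_le.trans (by gcongr)

lemma pathLaw_dist_limit_le (hf : Continuous f) (hs : 0 ≤ s) (hz : T.IsTypical z) (ρ : ℝ≥0) :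
    pathLaw T.law {z' | dist (f (T.limit z)) (f (T.limit z')) ≤ ρ} ≤
      2 * K * (6 * ρ / (T.node []).rad) ^ s := by
  have h_subset : {z' | dist (f (T.limit z)) (f (T.limit z')) ≤ ρ} ≤ᵐ[pathLaw T.law]
      ({z} ∪ ⋃ k, T.leavingPaths z k (6 * ρ) : Set (ℕ → ℕ)) := by
    filter_upwards [ae_isTypical T] with z' hz' h_dist
    rcases eq_or_ne z z' with rfl | h_ne
    · exact Or.inl rfl
    · exact Or.inr (mem_iUnion.2 ⟨_, mem_leavingPaths_firstDiff hf hz hz' h_ne h_dist⟩)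
  calc pathLaw T.law {z' | dist (f (T.limit z)) (f (T.limit z')) ≤ ρ}
      ≤ pathLaw T.law {z} + ∑' k, pathLaw T.law (T.leavingPaths z k (6 * ρ)) :=
        (measure_mono_ae h_subset).trans <| (measure_union_le _ _).trans <| by
          gcongr
          exact measure_iUnion_le _
    _ ≤ ∑' k, 2⁻¹ ^ k * (K * (6 * ρ / (T.node []).rad) ^ s) := by
        rw [pathLaw_singleton hs hz, zero_add]
        exact ENNReal.tsum_le_tsum fun k => by
          simpa using pathLaw_leavingPaths_le hs hz k (6 * ρ)
    _ = 2 * K * (6 * ρ / (T.node []).rad) ^ s := by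
        rw [ENNReal.tsum_mul_right, ENNReal.tsum_geometric, ENNReal.one_sub_inv_two, inv_inv,
          mul_assoc]

end FrostmanTree

end Tree

section Energy

variable {X : Type*} [MetricSpace X]

lemma exists_continuous_surjective_of_analyticSet [Nonempty X]
    (hX : AnalyticSet (univ : Set X)) :
    ∃ f : (ℕ → ℕ) → X, Continuous f ∧ Function.Surjective f := by
  rw [AnalyticSet] at hX
  obtain ⟨f, hf, hf_range⟩ := hX.resolve_left univ_nonempty.ne_empty
  exact ⟨f, hf, range_eq_univ.1 hf_range⟩

lemma separableSpace_of_analyticSet (hX : AnalyticSet (univ : Set X)) : SeparableSpace X := by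
  rcases isEmpty_or_nonempty X with _ | _
  · infer_instance
  · obtain ⟨f, hf, hf_surj⟩ := exists_continuous_surjective_of_analyticSet hX
    exact hf_surj.denseRange.separableSpace hf

lemma edist_rpow_neg_le_tsum {s : ℝ} {x y : X} (hxy : x ≠ y) (hs : 0 ≤ s) :
    edist x y ^ (-s) ≤
      1 + ∑' n : ℕ, (closedBall x ((2⁻¹ : ℝ≥0) ^ n : ℝ≥0)).indicator
        (fun _ => (2 ^ s : ℝ≥0∞) ^ (n + 1)) y := by
  rcases le_or_gt 1 (dist x y) with h_far | h_near
  · refine le_add_right ?_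
    rw [ENNReal.rpow_neg, ENNReal.inv_le_one, edist_dist]
    simpa using ENNReal.rpow_le_rpow (ENNReal.one_le_ofReal.2 h_far) hs
  · obtain ⟨n, hn, hn'⟩ := exists_nat_pow_near_of_lt_one (dist_pos.2 hxy) h_near.le
      (y := (2⁻¹ : ℝ)) (by norm_num) (by norm_num)
    have h_edist : ((2⁻¹ : ℝ≥0) ^ (n + 1) : ℝ≥0) ≤ edist x y := by
      rw [edist_nndist, ENNReal.coe_le_coe, ← NNReal.coe_le_coe]
      simpa using hn.le
    have h_mem : y ∈ closedBall x ((2⁻¹ : ℝ≥0) ^ n : ℝ≥0) := by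
      rw [mem_closedBall']
      simpa using hn'
    calc edist x y ^ (-s) ≤ ((2⁻¹ : ℝ≥0) ^ (n + 1) : ℝ≥0) ^ (-s) := by
          rw [ENNReal.rpow_neg, ENNReal.rpow_neg]
          gcongr
      _ = (2 ^ s : ℝ≥0∞) ^ (n + 1) := by
          rw [ENNReal.coe_pow, ENNReal.coe_inv two_ne_zero, ENNReal.coe_ofNat, ← ENNReal.inv_pow,
            ENNReal.inv_rpow, ENNReal.rpow_neg, inv_inv, ← ENNReal.rpow_natCast,
            ← ENNReal.rpow_natCast, ← ENNReal.rpow_mul, ← ENNReal.rpow_mul, mul_comm]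
      _ ≤ ∑' n : ℕ, (closedBall x ((2⁻¹ : ℝ≥0) ^ n : ℝ≥0)).indicator
            (fun _ => (2 ^ s : ℝ≥0∞) ^ (n + 1)) y :=
          (indicator_of_mem h_mem fun _ => (2 ^ s : ℝ≥0∞) ^ (n + 1)).symm.trans_le
            (ENNReal.le_tsum (f := fun n : ℕ => (closedBall x ((2⁻¹ : ℝ≥0) ^ n : ℝ≥0)).indicator
              (fun _ => (2 ^ s : ℝ≥0∞) ^ (n + 1)) y) n)
      _ ≤ _ := le_add_self

variable [MeasurableSpace X] [BorelSpace X] {s t : ℝ}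

lemma FrostmanTree.exists_measure_closedBall_le {f : (ℕ → ℕ) → X} {K : ℝ≥0∞}
    (T : FrostmanTree f s K) (hf : Continuous f) (hs : 0 ≤ s) (hK : K ≠ ∞) :
    ∃ μ : Measure X, IsProbabilityMeasure μ ∧ ∃ C : ℝ≥0∞, C ≠ ∞ ∧
      ∀ (x : X) (ρ : ℝ≥0), μ (closedBall x ρ) ≤ C * ρ ^ s := by
  have h_meas : Measurable fun z => f (T.limit z) := (hf.comp T.continuous_limit).measurable
  have h_rad : ((T.node []).rad : ℝ≥0∞) ≠ 0 := ENNReal.coe_ne_zero.2 (T.rad_pos _).ne'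
  refine ⟨(pathLaw T.law).map fun z => f (T.limit z),
    Measure.isProbabilityMeasure_map h_meas.aemeasurable,
    2 * K * (12 / (T.node []).rad) ^ s, ?_, fun x ρ => ?_⟩
  · exact ENNReal.mul_ne_top (ENNReal.mul_ne_top (by simp) hK)
      (ENNReal.rpow_ne_top_of_nonneg hs (ENNReal.div_ne_top (by simp) h_rad))
  rw [Measure.map_apply h_meas measurableSet_closedBall]
  set S := (fun z => f (T.limit z)) ⁻¹' closedBall x ρ
  rcases eq_or_ne (pathLaw T.law S) 0 with h_zero | h_ne_zero
  · exact h_zero.trans_le zero_le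
  obtain ⟨z, hzS, hz⟩ :=
    ((frequently_ae_mem_iff.2 h_ne_zero).and_eventually (ae_isTypical T)).exists
  have h_subset : S ⊆ {z' | dist (f (T.limit z)) (f (T.limit z')) ≤ (2 * ρ : ℝ≥0)} := by
    intro z' hz'
    rw [mem_ofPred_eq, NNReal.coe_mul, NNReal.coe_ofNat, two_mul]
    exact (dist_triangle_right _ _ x).trans (add_le_add hzS hz')
  calc pathLaw T.law S
      ≤ 2 * K * (6 * (2 * ρ : ℝ≥0) / (T.node []).rad) ^ s :=
        (measure_mono h_subset).trans (pathLaw_dist_limit_le hf hs hz (2 * ρ))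
    _ = 2 * K * (12 / (T.node []).rad) ^ s * ρ ^ s := by
        rw [mul_assoc (2 * K), ← ENNReal.mul_rpow_of_nonneg _ _ hs]
        congr 2
        rw [ENNReal.coe_mul, ENNReal.coe_ofNat, div_eq_mul_inv, div_eq_mul_inv]
        ring

theorem exists_frostman_measure (hX : AnalyticSet (univ : Set X)) (hs : 0 ≤ s)
    (hs_dim : ENNReal.ofReal s < dimH (univ : Set X)) :
    ∃ μ : Measure X, IsProbabilityMeasure μ ∧ ∃ C : ℝ≥0∞, C ≠ ∞ ∧
      ∀ (x : X) (ρ : ℝ≥0), μ (closedBall x ρ) ≤ C * ρ ^ s := by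
  have : SeparableSpace X := separableSpace_of_analyticSet hX
  have : Nonempty X := by
    by_contra h
    simp [not_nonempty_iff.1 h, univ_eq_empty_iff.2] at hs_dim
  obtain ⟨f, hf, hf_surj⟩ := exists_continuous_surjective_of_analyticSet hX
  obtain ⟨t, hst, ht_dim⟩ := ENNReal.lt_iff_exists_nnreal_btwn.1 hs_dim
  replace hst : s < t := (ENNReal.ofReal_lt_coe_iff hs).1 hst
  have ht : 0 < (t : ℝ) := hs.trans_lt hst
  obtain ⟨x, hx⟩ : ∃ x, x ∉ exceptionalSet t f := by
    by_contra! h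
    have h_zero := hausdorffMeasure_eq_zero_of_hausdorffContent_eq_zero ht
      (hausdorffContent_exceptionalSet ht f)
    rw [eq_univ_of_forall h, hausdorffMeasure_of_lt_dimH ht_dim] at h_zero
    exact ENNReal.top_ne_zero h_zero
  obtain ⟨z, rfl⟩ := hf_surj x
  obtain ⟨r, -, h_good⟩ := exists_isGoodNode ht 0 hx one_pos
  obtain ⟨K, hK, ⟨T⟩⟩ := FrostmanTree.exists_of_isGoodNode f hs hst h_good
  exact T.exists_measure_closedBall_le hf hs hK

lemma lintegral_edist_rpow_neg_le {μ : Measure X} {C : ℝ≥0∞} (hs : 0 ≤ s) (hst : s < t)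
    (hμ : ∀ (x : X) (ρ : ℝ≥0), μ (closedBall x ρ) ≤ C * ρ ^ t) (x : X) :
    ∫⁻ y, edist x y ^ (-s) ∂μ ≤ μ univ + 2 ^ s * C * (1 - 2 ^ (s - t))⁻¹ := by
  have h_ne : ∀ᵐ y ∂μ, x ≠ y := by
    refine measure_mono_null (t := closedBall x (0 : ℝ≥0)) (fun y hy => ?_) ?_
    · simpa using (not_not.1 hy).symm
    · simpa [ENNReal.zero_rpow_of_pos (hs.trans_lt hst)] using hμ x 0
  have h_term (n : ℕ) : (2 ^ s : ℝ≥0∞) ^ (n + 1) * (C * ((2⁻¹ : ℝ≥0) ^ n : ℝ≥0) ^ t) =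
      2 ^ s * C * (2 ^ (s - t)) ^ n := by
    have h_rpow : (((2⁻¹ : ℝ≥0) ^ n : ℝ≥0) : ℝ≥0∞) ^ t = (2 ^ (-t)) ^ n := by
      rw [ENNReal.coe_pow, ENNReal.coe_inv two_ne_zero, ENNReal.coe_ofNat, ← ENNReal.rpow_natCast,
        ← ENNReal.rpow_natCast, ← ENNReal.rpow_mul, mul_comm, ENNReal.rpow_mul, ENNReal.inv_rpow,
        ENNReal.rpow_neg]
    rw [h_rpow, sub_eq_add_neg, ENNReal.rpow_add _ _ two_ne_zero ENNReal.ofNat_ne_top, mul_pow]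
    ring
  calc ∫⁻ y, edist x y ^ (-s) ∂μ
      ≤ ∫⁻ y, (1 + ∑' n : ℕ, (closedBall x ((2⁻¹ : ℝ≥0) ^ n : ℝ≥0)).indicator
          (fun _ => (2 ^ s : ℝ≥0∞) ^ (n + 1)) y) ∂μ :=
        lintegral_mono_ae (h_ne.mono fun y hy => edist_rpow_neg_le_tsum hy hs)
    _ = μ univ + ∑' n : ℕ, (2 ^ s : ℝ≥0∞) ^ (n + 1) * μ (closedBall x ((2⁻¹ : ℝ≥0) ^ n : ℝ≥0)) := by
        rw [lintegral_add_left measurable_const, lintegral_one, lintegral_tsum fun n =>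
          (measurable_const.indicator measurableSet_closedBall).aemeasurable]
        simp only [lintegral_indicator_const measurableSet_closedBall]
    _ ≤ μ univ + ∑' n : ℕ, 2 ^ s * C * (2 ^ (s - t)) ^ n := by
        gcongr μ univ + ?_
        exact ENNReal.tsum_le_tsum fun n => (mul_le_mul_right (hμ x _) _).trans_eq (h_term n)
    _ = μ univ + 2 ^ s * C * (1 - 2 ^ (s - t))⁻¹ := by
        rw [ENNReal.tsum_mul_left, ENNReal.tsum_geometric]

theorem exists_measure_lintegral_edist_rpow_neg_ne_top (hX : AnalyticSet (univ : Set X))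
    (hs : 0 ≤ s) (hs_dim : ENNReal.ofReal s < dimH (univ : Set X)) :
    ∃ μ : Measure X, IsProbabilityMeasure μ ∧ ∫⁻ x, ∫⁻ y, edist x y ^ (-s) ∂μ ∂μ ≠ ∞ := by
  obtain ⟨t, hst, ht_dim⟩ := ENNReal.lt_iff_exists_nnreal_btwn.1 hs_dim
  replace hst : s < t := (ENNReal.ofReal_lt_coe_iff hs).1 hst
  rw [← ENNReal.ofReal_coe_nnreal] at ht_dim
  obtain ⟨μ, h_prob, C, hC, hμ⟩ := exists_frostman_measure hX t.coe_nonneg ht_dim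
  have h_ratio : (2 : ℝ≥0∞) ^ (s - t) < 1 :=
    ENNReal.rpow_lt_one_of_one_lt_of_neg (by norm_num) (sub_neg.2 hst)
  refine ⟨μ, h_prob, ne_top_of_le_ne_top ?_
    (lintegral_mono fun x => lintegral_edist_rpow_neg_le hs hst hμ x)⟩
  rw [lintegral_const, measure_univ, mul_one]
  exact ENNReal.add_ne_top.2 ⟨ENNReal.one_ne_top, ENNReal.mul_ne_top
    (ENNReal.mul_ne_top (ENNReal.rpow_ne_top_of_nonneg hs (by simp)) hC)
    (ENNReal.inv_ne_top.2 (tsub_pos_of_lt h_ratio).ne')⟩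

end Energy

section Analytic

lemma exists_cylinder_subset_of_isOpen {U : Set (ℕ → ℕ)} (hU : IsOpen U) {w : ℕ → ℕ}
    (hw : w ∈ U) : ∃ k, PiNat.cylinder w k ⊆ U := by
  obtain ⟨_, ⟨z, k, rfl⟩, hw_mem, h_subset⟩ :=
    (PiNat.isTopologicalBasis_cylinders fun _ : ℕ => ℕ).exists_subset_of_mem_open hw hU
  exact ⟨k, PiNat.mem_cylinder_iff_eq.1 hw_mem ▸ h_subset⟩

lemma exists_forall_lt_le_subset_of_isOpen {n : ℕ → ℕ} {U : Set (ℕ → ℕ)} (hU : IsOpen U)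
    (h_subset : Iic n ⊆ U) : ∃ k, {z | ∀ i < k, z i ≤ n i} ⊆ U := by
  have h_compact : IsCompact (Iic n) := by
    rw [← pi_univ_Iic]
    exact isCompact_univ_pi fun i => (finite_Iic (n i)).isCompact
  choose! κ hκ using fun w (hw : w ∈ Iic n) => exists_cylinder_subset_of_isOpen hU (h_subset hw)
  obtain ⟨F, hF, h_cover⟩ := h_compact.elim_nhds_subcover (fun w => PiNat.cylinder w (κ w))
    fun w _ => (PiNat.isOpen_cylinder _ w _).mem_nhds (PiNat.self_mem_cylinder w _)
  refine ⟨F.sup κ, fun z hz => ?_⟩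
  obtain ⟨w, hw, h_mem⟩ := mem_iUnion₂.1 (h_cover (mem_Iic.2 (inf_le_right : z ⊓ n ≤ n)))
  refine hκ w (hF w hw) fun i hi => ?_
  rw [← h_mem i hi, Pi.inf_apply, inf_of_le_left (hz i (hi.trans_le (Finset.le_sup hw)))]

lemma exists_forall_lt_measure_image_forall_lt_le {W : Type*} [MeasurableSpace W]
    {ρ : Measure W} {g : (ℕ → ℕ) → W} {a : ℝ≥0∞} (ha : a < ρ (range g)) :
    ∃ n : ℕ → ℕ, ∀ k, a < ρ (g '' {z | ∀ i < k, z i ≤ n i}) := by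
  have h_step (k : ℕ) (A : Set (ℕ → ℕ)) (hA : a < ρ (g '' A)) :
      ∃ m : ℕ, a < ρ (g '' (A ∩ {z | z k ≤ m})) := by
    have h_mono : Monotone fun m : ℕ => g '' (A ∩ {z | z k ≤ m}) := fun m m' h =>
      image_mono (inter_subset_inter_right _ fun z (hz : z k ≤ m) => hz.trans h)
    have h_iUnion : g '' A = ⋃ m : ℕ, g '' (A ∩ {z | z k ≤ m}) := by
      rw [← image_iUnion, ← inter_iUnion, inter_eq_left.2]
      exact fun z _ => mem_iUnion.2 ⟨z k, le_refl (z k)⟩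
    rwa [h_iUnion, h_mono.measure_iUnion, lt_iSup_iff] at hA
  choose! m hm using h_step
  let A : ℕ → Set (ℕ → ℕ) := Nat.rec univ fun k A => A ∩ {z | z k ≤ m k A}
  have h_lt (k : ℕ) : a < ρ (g '' A k) := by
    induction k with
    | zero => rwa [← image_univ] at ha
    | succ k ih => exact hm k _ ih
  have h_eq (k : ℕ) : A k = {z | ∀ i < k, z i ≤ m i (A i)} := by
    induction k with
    | zero => simp [A]
    | succ k ih =>
      ext z
      rw [mem_ofPred_eq, Nat.forall_lt_succ_right]
      exact and_congr_left' (Set.ext_iff.1 ih z)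
  exact ⟨fun k => m k (A k), fun k => h_eq k ▸ h_lt k⟩

variable {W : Type*} [TopologicalSpace W] [MeasurableSpace W] {ρ : Measure W}

lemma exists_isCompact_le_measure_image [ρ.OuterRegular] {g : (ℕ → ℕ) → W} (hg : Continuous g)
    {a : ℝ≥0∞} (ha : a < ρ (range g)) : ∃ K : Set (ℕ → ℕ), IsCompact K ∧ a ≤ ρ (g '' K) := by
  obtain ⟨n, hn⟩ := exists_forall_lt_measure_image_forall_lt_le ha
  refine ⟨Iic n, ?_, ?_⟩
  · rw [← pi_univ_Iic]
    exact isCompact_univ_pi fun i => (finite_Iic (n i)).isCompact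
  rw [(g '' Iic n).measure_eq_iInf_isOpen ρ]
  refine le_iInf₂ fun O hO => le_iInf fun hO_open => ?_
  obtain ⟨k, hk⟩ := exists_forall_lt_le_subset_of_isOpen (hO_open.preimage hg)
    (image_subset_iff.1 hO)
  exact (hn k).le.trans (measure_mono (image_subset_iff.2 hk))

lemma nullMeasurableSet_of_analyticSet [T2Space W] [BorelSpace W] [IsFiniteMeasure ρ]
    [ρ.OuterRegular] {S : Set W} (hS : AnalyticSet S) : NullMeasurableSet S ρ := by
  rw [AnalyticSet] at hS
  obtain rfl | ⟨g, hg, rfl⟩ := hS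
  · exact MeasurableSet.empty.nullMeasurableSet
  rcases eq_or_ne (ρ (range g)) 0 with h_zero | h_ne_zero
  · exact NullMeasurableSet.of_null h_zero
  obtain ⟨a, -, ha, h_lim⟩ := exists_seq_strictMono_tendsto' (pos_iff_ne_zero.2 h_ne_zero)
  choose K hK hKa using fun j => exists_isCompact_le_measure_image hg (ha j).2
  have h_meas : MeasurableSet (⋃ j, g '' K j) :=
    MeasurableSet.iUnion fun j => ((hK j).image hg).isClosed.measurableSet
  have h_subset : (⋃ j, g '' K j) ⊆ range g := iUnion_subset fun j => image_subset_range _ _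
  have h_le : ρ (range g) ≤ ρ (⋃ j, g '' K j) := le_of_tendsto' h_lim fun j =>
    (hKa j).trans (measure_mono (subset_iUnion (fun j => g '' K j) j))
  exact h_meas.nullMeasurableSet.congr
    (ae_eq_of_subset_of_measure_ge h_subset h_le h_meas.nullMeasurableSet (measure_ne_top _ _))

/-- Reduces measurable sets over an arbitrary measurable space to Borel sets over Cantor space. -/
lemma exists_preimage_prodMap_eq {W Z : Type*} [MeasurableSpace W] [MeasurableSpace Z]
    {M : Set (W × Z)} (hM : MeasurableSet M) :
    ∃ φ : W → ℕ → Bool, Measurable φ ∧ ∃ M₀ : Set ((ℕ → Bool) × Z), MeasurableSet M₀ ∧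
      M = Prod.map φ id ⁻¹' M₀ := by
  classical
  induction M, hM using MeasurableSpace.induction_on_inter generateFrom_prod.symm
    isPiSystem_prod with
  | empty => exact ⟨fun _ _ => true, measurable_const, ∅, MeasurableSet.empty, by simp⟩
  | basic M hM =>
    obtain ⟨A, hA, B, hB, rfl⟩ := hM
    refine ⟨fun w _ => decide (w ∈ A), measurable_pi_iff.2 fun _ => measurable_to_bool ?_,
      ((fun x => x 0) ⁻¹' {true}) ×ˢ B,
      (measurable_pi_apply 0 (measurableSet_singleton true)).prod hB, ?_⟩
    · rwa [show (fun w => decide (w ∈ A)) ⁻¹' {true} = A by ext; simp]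
    · ext ⟨w, z⟩
      simp
  | compl M _ ih =>
    obtain ⟨φ, hφ, M₀, hM₀, rfl⟩ := ih
    exact ⟨φ, hφ, M₀ᶜ, hM₀.compl, rfl⟩
  | iUnion M _ _ ih =>
    choose φ hφ M₀ hM₀ h_eq using ih
    have h_section (n : ℕ) : Measurable fun (x : ℕ → Bool) (j : ℕ) => x (Nat.pair n j) :=
      measurable_pi_iff.2 fun j => measurable_pi_apply _
    refine ⟨fun w m => φ m.unpair.1 w m.unpair.2, measurable_pi_iff.2 fun m =>
      (measurable_pi_apply _).comp (hφ _),
      ⋃ n, Prod.map (fun (x : ℕ → Bool) (j : ℕ) => x (Nat.pair n j)) id ⁻¹' M₀ n,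
      MeasurableSet.iUnion fun n => ((h_section n).prodMap measurable_id) (hM₀ n), ?_⟩
    rw [preimage_iUnion]
    refine iUnion_congr fun n => (h_eq n).trans ?_
    ext ⟨w, z⟩
    simp

theorem nullMeasurableSet_image_fst {W : Type*} [MeasurableSpace W] {ρ : Measure W} [SFinite ρ]
    {M : Set (W × (ℕ → ℕ))} (hM : MeasurableSet M) : NullMeasurableSet (Prod.fst '' M) ρ := by
  obtain ⟨φ, hφ, M₀, hM₀, rfl⟩ := exists_preimage_prodMap_eq hM
  have h_image : Prod.fst '' (Prod.map φ id ⁻¹' M₀) = φ ⁻¹' (Prod.fst '' M₀) := by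
    ext w
    simp
  have h_null : NullMeasurableSet (Prod.fst '' M₀) (ρ.toFinite.map φ) :=
    nullMeasurableSet_of_analyticSet (hM₀.analyticSet_image measurable_fst)
  rw [h_image]
  exact (h_null.preimage (hφ.quasiMeasurePreserving _)).mono_ac (absolutelyContinuous_toFinite ρ)

lemma aemeasurable_measure_range {Λ Y : Type*} [MeasurableSpace Λ] {P : Measure Λ} [SFinite P]
    [MeasurableSpace Y] [MeasurableEq Y] {η : Measure Y} [SFinite η] {g : Λ → (ℕ → ℕ) → Y}
    (hg : Measurable (Function.uncurry g)) : AEMeasurable (fun ω => η (range (g ω))) P := by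
  set M : Set ((Λ × Y) × (ℕ → ℕ)) := {p | g p.1.1 p.2 = p.1.2}
  have hM : MeasurableSet M := measurableSet_eq_fun
    (hg.comp (measurable_fst.fst.prodMk measurable_snd)) measurable_fst.snd
  have h_section (ω : Λ) : range (g ω) = Prod.mk ω ⁻¹' (Prod.fst '' M) := by
    ext y
    simp [M]
  obtain ⟨G, hG, hGM⟩ : NullMeasurableSet (Prod.fst '' M) (P.prod η) :=
    nullMeasurableSet_image_fst hM
  refine ⟨fun ω => η (Prod.mk ω ⁻¹' G), measurable_measure_prodMk_left hG, ?_⟩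
  filter_upwards [Measure.ae_ae_of_ae_prod hGM] with ω hω
  rw [h_section]
  exact measure_congr hω

end Analytic

section Density

lemma inv_two_le_measure_lt {Ω : Type*} [MeasurableSpace Ω] {μ : Measure Ω}
    [IsProbabilityMeasure μ] {F : Ω → ℝ≥0∞} (hF : Measurable F) (h_fin : ∫⁻ z, F z ∂μ ≠ ∞) :
    2⁻¹ ≤ μ {z | F z < 2 * ∫⁻ z, F z ∂μ + 1} := by
  set M := 2 * ∫⁻ z, F z ∂μ + 1
  have h_markov : μ {z | M ≤ F z} ≤ 2⁻¹ := by
    refine (meas_ge_le_lintegral_div hF.aemeasurable (by simp [M]) (by finiteness)).trans ?_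
    refine ENNReal.div_le_of_le_mul ?_
    rw [mul_add, ← mul_assoc, ENNReal.inv_mul_cancel (by simp) (by simp), one_mul]
    exact le_self_add
  have h_compl : {z | F z < M} = {z | M ≤ F z}ᶜ := by
    ext
    simp
  rw [h_compl, prob_compl_eq_one_sub (measurableSet_le measurable_const hF)]
  refine ENNReal.le_sub_of_add_le_left (by finiteness) ?_
  exact (add_le_add_left h_markov _).trans_eq ENNReal.inv_two_add_inv_two

variable {Y : Type*} [MetricSpace Y] [MeasurableSpace Y] {η : Measure Y} {κ : ℝ}

lemma eventually_mul_le_measure_closedBall_div {c : ℝ≥0∞} {y : Y} (hy : c < kappaDensity κ η y)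
    {a : ℝ} (ha : 0 < a) :
    ∀ᶠ r : ℝ in 𝓝[>] 0, c * ENNReal.ofReal ((r / a) ^ κ) ≤ η (closedBall y (r / a)) := by
  have h_lim : Tendsto (fun r : ℝ => r / a) (𝓝[>] 0) (𝓝[>] 0) := by
    refine tendsto_nhdsWithin_iff.2 ⟨?_, ?_⟩
    · simpa using ((continuous_id.div_const a).tendsto 0).mono_left nhdsWithin_le_nhds
    · filter_upwards [self_mem_nhdsWithin] with r hr using div_pos hr ha
  exact h_lim.eventually ((eventually_lt_of_lt_liminf hy).mono
    fun r hr => ENNReal.mul_le_of_le_div hr.le)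

variable [BorelSpace Y] {Ω : Type*} [MeasurableSpace Ω] {μ : Measure Ω} {h : Ω → Y}

/-- The lower `κ`-density of the image measure `h_* μ` at `h z`, along the radii `2⁻ⁿ` only, so
that it is measurable in `z` (and in a parameter of `h`). -/
def imageDensity (μ : Measure Ω) (κ : ℝ) (h : Ω → Y) (z : Ω) : ℝ≥0∞ :=
  liminf (fun n : ℕ => μ {z' | dist (h z) (h z') ≤ (1 / 2) ^ n} /
    ENNReal.ofReal (((1 / 2) ^ n) ^ κ)) atTop

lemma frequently_map_closedBall_le (hh : Measurable h) {M : ℝ≥0∞} {z : Ω}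
    (hz : imageDensity μ κ h z < M) :
    ∃ᶠ r : ℝ in 𝓝[>] 0, μ.map h (closedBall (h z) r) ≤ M * ENNReal.ofReal (r ^ κ) := by
  have h_lim : Tendsto (fun n : ℕ => ((1 : ℝ) / 2) ^ n) atTop (𝓝[>] 0) :=
    tendsto_pow_atTop_nhdsWithin_zero_of_lt_one (by norm_num) (by norm_num)
  refine h_lim.frequently ((frequently_lt_of_liminf_lt (by isBoundedDefault) hz).mono
    fun n hn => ?_)
  have h_pos : ENNReal.ofReal (((1 / 2) ^ n) ^ κ) ≠ 0 := (ENNReal.ofReal_pos.2 (by positivity)).ne'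
  rw [Measure.map_apply hh isClosed_closedBall.measurableSet,
    ← ENNReal.div_le_iff_le_mul (Or.inl h_pos) (Or.inl ENNReal.ofReal_ne_top)]
  simpa only [preimage, mem_closedBall'] using hn.le

variable [SeparableSpace Y]

lemma measure_le_mul_measure_of_isOpen {ν : Measure Y} {L : ℝ≥0∞} {G O : Set Y}
    (hO : IsOpen O) (hGO : G ⊆ O)
    (h : ∀ y ∈ G, ∃ᶠ r : ℝ in 𝓝[>] 0, ν (closedBall y r) ≤ L * η (closedBall y (r / 5))) :
    ν G ≤ L * η O := by
  have h_radius (y : Y) (hy : y ∈ G) : ∃ r : ℝ, ν (closedBall y r) ≤ L * η (closedBall y (r / 5)) ∧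
      0 < r ∧ r ≤ 1 ∧ closedBall y r ⊆ O := by
    have h_small : ∀ᶠ r : ℝ in 𝓝[>] 0, r ≤ 1 ∧ closedBall y r ⊆ O := nhdsWithin_le_nhds
      ((ge_mem_nhds one_pos).and (eventually_closedBall_subset (hO.mem_nhds (hGO hy))))
    exact ((h y hy).and_eventually (eventually_mem_nhdsWithin.and h_small)).exists
  choose! r hr_le hr_pos hr_one hr_subset using h_radius
  obtain ⟨u, hu_subset, h_disjoint, h_cover⟩ :=
    Vitali.exists_disjoint_subfamily_covering_enlargement_closedBall G id (fun y => r y / 5) 1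
      (fun y hy => by linarith [hr_one y hy, hr_pos y hy]) 5 (by norm_num)
  have hu : u.Countable := h_disjoint.countable_of_nonempty_interior fun y hy =>
    ⟨y, ball_subset_interior_closedBall (mem_ball_self (by linarith [hr_pos y (hu_subset hy)]))⟩
  have hG_subset : G ⊆ ⋃ y ∈ u, closedBall y (r y) := fun y hy => by
    obtain ⟨b, hb, h_subset⟩ := h_cover y hy
    rw [mul_div_cancel₀ _ (by norm_num : (5 : ℝ) ≠ 0)] at h_subset
    exact mem_iUnion₂.2 ⟨b, hb, h_subset (mem_closedBall_self (by linarith [hr_pos y hy]))⟩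
  calc ν G ≤ ∑' y : u, ν (closedBall y (r y)) :=
        (measure_mono hG_subset).trans (measure_biUnion_le ν hu _)
    _ ≤ ∑' y : u, L * η (closedBall y (r y / 5)) :=
        ENNReal.tsum_le_tsum fun y => hr_le y (hu_subset y.2)
    _ = L * η (⋃ y ∈ u, closedBall y (r y / 5)) := by
        rw [ENNReal.tsum_mul_left, measure_biUnion (f := fun y => closedBall y (r y / 5)) hu
          h_disjoint fun y _ => isClosed_closedBall.measurableSet]
    _ ≤ L * η O := by
        gcongr
        refine iUnion₂_subset fun y hy => ?_
        have hr := hr_pos y (hu_subset hy)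
        exact (closedBall_subset_closedBall (by linarith)).trans (hr_subset y (hu_subset hy))

lemma measure_le_mul_measure {ν : Measure Y} [η.OuterRegular] {L : ℝ≥0∞} (hL : L ≠ ∞)
    {G : Set Y}
    (h : ∀ y ∈ G, ∃ᶠ r : ℝ in 𝓝[>] 0, ν (closedBall y r) ≤ L * η (closedBall y (r / 5))) :
    ν G ≤ L * η G := by
  rcases eq_or_ne L 0 with rfl | hL_ne_zero
  · simpa using measure_le_mul_measure_of_isOpen isOpen_univ (subset_univ G) h
  have h_mul (m : ℝ≥0∞) : ν G ≤ L * m ↔ ν G / L ≤ m := by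
    rw [ENNReal.div_le_iff_le_mul (Or.inl hL_ne_zero) (Or.inl hL), mul_comm]
  rw [h_mul, G.measure_eq_iInf_isOpen η]
  exact le_iInf₂ fun O hO => le_iInf fun hO_open =>
    (h_mul _).1 (measure_le_mul_measure_of_isOpen hO_open hO h)

lemma measure_imageDensity_lt_le (hh : Measurable h) [η.OuterRegular] {M c : ℝ≥0∞} (hM : M ≠ ∞)
    (hc : c ≠ 0) :
    μ {z | imageDensity μ κ h z < M ∧ c < kappaDensity κ η (h z)} ≤
      M * ENNReal.ofReal (5 ^ κ) / c * η (range h) := by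
  set S := {z | imageDensity μ κ h z < M ∧ c < kappaDensity κ η (h z)}
  have h_ball : ∀ y ∈ h '' S, ∃ᶠ r : ℝ in 𝓝[>] 0, μ.map h (closedBall y r) ≤
      M * ENNReal.ofReal (5 ^ κ) / c * η (closedBall y (r / 5)) := by
    rintro _ ⟨z, ⟨hzM, hzc⟩, rfl⟩
    refine ((frequently_map_closedBall_le hh hzM).and_eventually (eventually_mem_nhdsWithin.and
      (eventually_mul_le_measure_closedBall_div hzc (a := 5) (by norm_num)))).mono
      fun r ⟨hμ, hr, hη⟩ => hμ.trans ?_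
    have h_rpow : r ^ κ = 5 ^ κ * (r / 5) ^ κ := by
      rw [← Real.mul_rpow (by norm_num) (div_nonneg (mem_Ioi.1 hr).le (by norm_num)),
        mul_div_cancel₀ _ (by norm_num : (5 : ℝ) ≠ 0)]
    calc M * ENNReal.ofReal (r ^ κ)
        = M * ENNReal.ofReal (5 ^ κ) / c * (c * ENNReal.ofReal ((r / 5) ^ κ)) := by
          rw [← mul_assoc, ENNReal.div_mul_cancel hc hzc.ne_top, h_rpow,
            ENNReal.ofReal_mul (by positivity), mul_assoc]
      _ ≤ _ := by gcongr
  calc μ S ≤ μ (h ⁻¹' (h '' S)) := measure_mono (subset_preimage_image h S)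
    _ ≤ μ.map h (h '' S) := Measure.le_map_apply hh.aemeasurable _
    _ ≤ M * ENNReal.ofReal (5 ^ κ) / c * η (h '' S) :=
        measure_le_mul_measure (by finiteness) h_ball
    _ ≤ M * ENNReal.ofReal (5 ^ κ) / c * η (range h) := by
        gcongr
        exact image_subset_range h S

lemma measure_range_pos_of_lintegral_ne_top [NeZero μ] (hh : Measurable h)
    (hη : IsKappaRegular κ η) (hm : Measurable (imageDensity μ κ h))
    (h_fin : ∫⁻ z, imageDensity μ κ h z ∂μ ≠ ∞) : 0 < η (range h) := by
  have := hη.outerRegular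
  rw [pos_iff_ne_zero]
  intro h_zero
  have h_null (n : ℕ) : ∀ᵐ z ∂μ,
      ¬ (imageDensity μ κ h z < n ∧ (n : ℝ≥0∞)⁻¹ < kappaDensity κ η (h z)) := by
    refine measure_eq_zero_iff_ae_notMem.1 (le_antisymm ?_ zero_le)
    refine (measure_imageDensity_lt_le hh (ENNReal.natCast_ne_top n) (by simp)).trans ?_
    rw [h_zero, mul_zero]
  obtain ⟨z, hz_fin, hz⟩ := ((ae_lt_top hm h_fin).and (ae_all_iff.2 h_null)).exists
  obtain ⟨n₁, hn₁⟩ := ENNReal.exists_nat_gt hz_fin.ne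
  obtain ⟨n₂, hn₂⟩ := ENNReal.exists_inv_nat_lt (hη.density_pos (h z)).ne'
  refine hz (max n₁ n₂) ⟨hn₁.trans_le ?_, lt_of_le_of_lt ?_ hn₂⟩
  · exact Nat.cast_le.2 (le_max_left n₁ n₂)
  · exact ENNReal.inv_le_inv.2 (Nat.cast_le.2 (le_max_right n₁ n₂))

lemma inv_measure_range_le [IsProbabilityMeasure μ] (hh : Measurable h) [η.OuterRegular]
    {c : ℝ≥0∞} (hc : c ≠ 0) (hη : ∀ y, c < kappaDensity κ η y)
    (hm : Measurable (imageDensity μ κ h)) (h_fin : ∫⁻ z, imageDensity μ κ h z ∂μ ≠ ∞) :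
    (η (range h))⁻¹ ≤
      2 * (2 * ∫⁻ z, imageDensity μ κ h z ∂μ + 1) * ENNReal.ofReal (5 ^ κ) / c := by
  set M := 2 * ∫⁻ z, imageDensity μ κ h z ∂μ + 1
  have h_half : 2⁻¹ ≤ M * ENNReal.ofReal (5 ^ κ) / c * η (range h) :=
    calc 2⁻¹ ≤ μ {z | imageDensity μ κ h z < M} := inv_two_le_measure_lt hm h_fin
      _ ≤ μ {z | imageDensity μ κ h z < M ∧ c < kappaDensity κ η (h z)} :=
        measure_mono fun z hz => ⟨hz, hη (h z)⟩
      _ ≤ _ := measure_imageDensity_lt_le hh (by finiteness) hc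
  rw [← one_div]
  refine ENNReal.div_le_of_le_mul ?_
  calc (1 : ℝ≥0∞) = 2 * 2⁻¹ := (ENNReal.mul_inv_cancel (by simp) (by simp)).symm
    _ ≤ 2 * (M * ENNReal.ofReal (5 ^ κ) / c * η (range h)) := by gcongr
    _ = 2 * M * ENNReal.ofReal (5 ^ κ) / c * η (range h) := by
      simp only [div_eq_mul_inv, mul_assoc]

end Density

section MeanEnergy

variable {Y Λ Ω : Type*} [MetricSpace Y] [SecondCountableTopology Y] [MeasurableSpace Y]
  [BorelSpace Y] [MeasurableSpace Λ] [MeasurableSpace Ω] {μ : Measure Ω} [SFinite μ]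
  {g : Λ → Ω → Y} {κ : ℝ}

lemma measurableSet_dist_le (hg : Measurable (Function.uncurry g)) (r : ℝ) :
    MeasurableSet {p : (Λ × Ω) × Ω | dist (g p.1.1 p.1.2) (g p.1.1 p.2) ≤ r} :=
  measurableSet_le ((hg.comp measurable_fst).dist
    (hg.comp (measurable_fst.fst.prodMk measurable_snd))) measurable_const

lemma measurable_measure_dist_le (hg : Measurable (Function.uncurry g)) (r : ℝ) :
    Measurable fun p : Λ × Ω => μ {z' | dist (g p.1 p.2) (g p.1 z') ≤ r} :=
  measurable_measure_prodMk_left (measurableSet_dist_le hg r)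

lemma measurable_imageDensity (hg : Measurable (Function.uncurry g)) (κ : ℝ) :
    Measurable fun p : Λ × Ω => imageDensity μ κ (g p.1) p.2 :=
  Measurable.liminf fun _ => (measurable_measure_dist_le hg _).div_const _

lemma measurable_imageDensity_apply (hg : Measurable (Function.uncurry g)) (κ : ℝ) (ω : Λ) :
    Measurable (imageDensity μ κ (g ω)) :=
  Measurable.of_uncurry_left (f := fun ω => imageDensity μ κ (g ω)) (measurable_imageDensity hg κ)

variable {P : Measure Λ}

lemma ae_measure_range_pos [NeZero μ] (hg : Measurable (Function.uncurry g)) {η : Measure Y}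
    (hη : IsKappaRegular κ η) (hJ : ∫⁻ ω, ∫⁻ z, imageDensity μ κ (g ω) z ∂μ ∂P ≠ ∞) :
    ∀ᵐ ω ∂P, 0 < η (range (g ω)) := by
  filter_upwards [ae_lt_top (measurable_imageDensity hg κ).lintegral_prod_right' hJ] with ω hω
  exact measure_range_pos_of_lintegral_ne_top (hg.comp measurable_prodMk_left) hη
    (measurable_imageDensity_apply hg κ ω) hω.ne

lemma lintegral_inv_measure_range_lt_top [IsProbabilityMeasure μ] [IsFiniteMeasure P]
    (hg : Measurable (Function.uncurry g)) {η : Measure Y} (hη : IsStronglyKappaRegular κ η)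
    (hJ : ∫⁻ ω, ∫⁻ z, imageDensity μ κ (g ω) z ∂μ ∂P ≠ ∞) :
    ∫⁻ ω, (η (range (g ω)))⁻¹ ∂P < ∞ := by
  have := hη.outerRegular
  obtain ⟨b, hb, hb_le⟩ := hη.density_ge
  obtain ⟨c, hc, hcb⟩ := exists_between hb
  calc ∫⁻ ω, (η (range (g ω)))⁻¹ ∂P
      ≤ ∫⁻ ω, 2 * (2 * ∫⁻ z, imageDensity μ κ (g ω) z ∂μ + 1) * ENNReal.ofReal (5 ^ κ) / c ∂P := by
        refine lintegral_mono_ae ?_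
        filter_upwards [ae_lt_top (measurable_imageDensity hg κ).lintegral_prod_right' hJ] with ω hω
        exact inv_measure_range_le (hg.comp measurable_prodMk_left) hc.ne'
          (fun y => hcb.trans_le (hb_le y)) (measurable_imageDensity_apply hg κ ω) hω.ne
    _ = 2 * (2 * ∫⁻ ω, ∫⁻ z, imageDensity μ κ (g ω) z ∂μ ∂P + P univ) *
          ENNReal.ofReal (5 ^ κ) / c := by
        simp only [div_eq_mul_inv]
        rw [lintegral_mul_const' _ _ (by finiteness),
          lintegral_mul_const' _ _ (by finiteness), lintegral_const_mul' _ _ (by finiteness),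
          lintegral_add_right _ measurable_const, lintegral_const_mul' _ _ (by finiteness),
          lintegral_one]
    _ < ∞ := by finiteness

variable [SFinite P]

lemma lintegral_measure_dist_le (hg : Measurable (Function.uncurry g)) (r : ℝ) (z : Ω) :
    ∫⁻ ω, μ {z' | dist (g ω z) (g ω z') ≤ r} ∂P = ∫⁻ z', P {ω | dist (g ω z) (g ω z') ≤ r} ∂μ := by
  have h_meas : MeasurableSet {q : Λ × Ω | dist (g q.1 z) (g q.1 q.2) ≤ r} :=
    (measurable_fst.prodMk measurable_const).prodMk measurable_snd (measurableSet_dist_le hg r)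
  exact (Measure.prod_apply h_meas).symm.trans (Measure.prod_apply_symm h_meas)

lemma lintegral_measure_dist_le_div_le (hg : Measurable (Function.uncurry g))
    {Φ : Ω → Ω → ℝ≥0∞} {r : ℝ}
    (hΦ : ∀ z z', P {ω | dist (g ω z) (g ω z') ≤ r} ≤ ENNReal.ofReal (r ^ κ) * Φ z z') :
    ∫⁻ p : Λ × Ω, μ {z' | dist (g p.1 p.2) (g p.1 z') ≤ r} / ENNReal.ofReal (r ^ κ) ∂P.prod μ ≤
      ∫⁻ z, ∫⁻ z', Φ z z' ∂μ ∂μ := by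
  simp only [div_eq_mul_inv]
  rw [lintegral_mul_const _ (measurable_measure_dist_le hg r),
    lintegral_prod_symm _ (measurable_measure_dist_le hg r).aemeasurable, ← div_eq_mul_inv]
  refine ENNReal.div_le_of_le_mul' ?_
  calc ∫⁻ z, ∫⁻ ω, μ {z' | dist (g ω z) (g ω z') ≤ r} ∂P ∂μ
      = ∫⁻ z, ∫⁻ z', P {ω | dist (g ω z) (g ω z') ≤ r} ∂μ ∂μ :=
        lintegral_congr (lintegral_measure_dist_le hg r)
    _ ≤ ∫⁻ z, ∫⁻ z', ENNReal.ofReal (r ^ κ) * Φ z z' ∂μ ∂μ :=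
        lintegral_mono fun z => lintegral_mono (hΦ z)
    _ = ENNReal.ofReal (r ^ κ) * ∫⁻ z, ∫⁻ z', Φ z z' ∂μ ∂μ := by
        simp only [lintegral_const_mul' _ _ ENNReal.ofReal_ne_top]

lemma lintegral_imageDensity_le (hg : Measurable (Function.uncurry g)) {Φ : Ω → Ω → ℝ≥0∞}
    (hΦ : ∀ r : ℝ, 0 < r → ∀ z z',
      P {ω | dist (g ω z) (g ω z') ≤ r} ≤ ENNReal.ofReal (r ^ κ) * Φ z z') :
    ∫⁻ ω, ∫⁻ z, imageDensity μ κ (g ω) z ∂μ ∂P ≤ ∫⁻ z, ∫⁻ z', Φ z z' ∂μ ∂μ :=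
  calc ∫⁻ ω, ∫⁻ z, imageDensity μ κ (g ω) z ∂μ ∂P
      = ∫⁻ p, imageDensity μ κ (g p.1) p.2 ∂P.prod μ :=
        (lintegral_prod _ (measurable_imageDensity hg κ).aemeasurable).symm
    _ ≤ liminf (fun n : ℕ => ∫⁻ p : Λ × Ω, μ {z' | dist (g p.1 p.2) (g p.1 z') ≤ (1 / 2) ^ n} /
          ENNReal.ofReal (((1 / 2) ^ n) ^ κ) ∂P.prod μ) atTop :=
        lintegral_liminf_le fun n => (measurable_measure_dist_le hg _).div_const _
    _ ≤ liminf (fun _ : ℕ => ∫⁻ z, ∫⁻ z', Φ z z' ∂μ ∂μ) atTop :=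
        liminf_le_liminf (Eventually.of_forall fun n =>
          lintegral_measure_dist_le_div_le hg (hΦ _ (by positivity)))
    _ = ∫⁻ z, ∫⁻ z', Φ z z' ∂μ ∂μ := liminf_const _

end MeanEnergy

section Transversality

lemma IsTransversal.measure_dist_le_le {X Y Λ : Type*} [MetricSpace X] [MetricSpace Y]
    [MeasurableSpace Λ] {P : Measure Λ} {π : Λ → X → Y} {α κ C : ℝ}
    (htrans : IsTransversal P π α κ C) (hακ : 0 < α * κ) (hC : 0 < C) {r : ℝ} (hr : 0 < r)
    (x x' : X) :
    P {ω | dist (π ω x) (π ω x') ≤ r} ≤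
      ENNReal.ofReal (r ^ κ) * (ENNReal.ofReal C * edist x x' ^ (-(α * κ))) := by
  rcases eq_or_ne x x' with rfl | hne
  · have h_pos : ENNReal.ofReal (r ^ κ) ≠ 0 := (ENNReal.ofReal_pos.2 (by positivity)).ne'
    rw [edist_self, ENNReal.zero_rpow_of_neg (neg_lt_zero.2 hακ),
      ENNReal.mul_top (ENNReal.ofReal_pos.2 hC).ne', ENNReal.mul_top h_pos]
    exact le_top
  have hd : 0 < dist x x' := dist_pos.2 hne
  have h_scale : r * dist x x' ^ (-α) * dist x x' ^ α = r := by
    rw [mul_assoc, ← Real.rpow_add hd, neg_add_cancel, Real.rpow_zero, mul_one]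
  calc P {ω | dist (π ω x) (π ω x') ≤ r}
      ≤ ENNReal.ofReal (C * (r * dist x x' ^ (-α)) ^ κ) := by
        simpa only [h_scale] using htrans (r * dist x x' ^ (-α)) (by positivity) x x' hne
    _ = ENNReal.ofReal (r ^ κ * (C * dist x x' ^ (-(α * κ)))) := by
        rw [Real.mul_rpow hr.le (by positivity), ← Real.rpow_mul hd.le, neg_mul]
        ring_nf
    _ = _ := by
        rw [edist_dist, ENNReal.ofReal_rpow_of_pos hd, ENNReal.ofReal_mul (by positivity),
          ENNReal.ofReal_mul hC.le]

end Transversality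

lemma analyticSet_univ_coe {E : Type*} [TopologicalSpace E] {X : Set E} (hX : AnalyticSet X) :
    AnalyticSet (univ : Set X) := by
  rw [AnalyticSet] at hX
  obtain rfl | ⟨f, hf, rfl⟩ := hX
  · simpa only [univ_eq_empty_iff.2 inferInstance] using analyticSet_empty
  · rw [← (rangeFactorization_surjective (f := f)).range_eq]
    exact analyticSet_range_of_polishSpace (hf.rangeFactorization)

lemma dimH_univ_coe {E : Type*} [EMetricSpace E] (X : Set E) : dimH (univ : Set X) = dimH X := by
  rw [← isometry_subtype_coe.dimH_image, image_univ, Subtype.range_coe]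

theorem theorem1p2_general
    {X Y Λ : Type*} [MetricSpace X] [MeasurableSpace X] [BorelSpace X]
    (hX : AnalyticSet (univ : Set X))
    [MetricSpace Y] [SeparableSpace Y] [MeasurableSpace Y] [BorelSpace Y]
    [MeasurableSpace Λ] (P : Measure Λ) [IsFiniteMeasure P]
    (π : Λ → X → Y) (hπ : Measurable (Function.uncurry π))
    (α κ C : ℝ) (hακ : 0 < α * κ) (hC : 0 < C) (htrans : IsTransversal P π α κ C)
    (hdim : ENNReal.ofReal (α * κ) < dimH (univ : Set X)) :
    (∀ η : Measure Y, IsKappaRegular κ η → ∀ᵐ ω ∂P, 0 < η (range (π ω))) ∧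
    (∀ η : Measure Y, IsStronglyKappaRegular κ η → SigmaFinite η →
      AEMeasurable (fun ω => (η (range (π ω)))⁻¹) P ∧ ∫⁻ ω, (η (range (π ω)))⁻¹ ∂P < ∞) := by
  have : SecondCountableTopology Y := UniformSpace.secondCountable_of_separable Y
  obtain ⟨μ, hμ, h_energy⟩ := exists_measure_lintegral_edist_rpow_neg_ne_top hX hακ.le hdim
  have : Nonempty X := μ.nonempty_of_neZero
  obtain ⟨f, hf, hf_surj⟩ := exists_continuous_surjective_of_analyticSet hX
  have hJ : ∫⁻ ω, ∫⁻ x, imageDensity μ κ (π ω) x ∂μ ∂P ≠ ∞ := by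
    refine ne_top_of_le_ne_top ?_ (lintegral_imageDensity_le hπ fun r hr =>
      htrans.measure_dist_le_le hακ hC hr)
    simp only [lintegral_const_mul' _ _ (ENNReal.ofReal_ne_top (r := C))]
    finiteness
  refine ⟨fun η hη => ae_measure_range_pos hπ hη hJ, fun η hη hη_sigma =>
    ⟨AEMeasurable.inv ?_, lintegral_inv_measure_range_lt_top hπ hη hJ⟩⟩
  simpa only [hf_surj.range_comp] using aemeasurable_measure_range (g := fun ω => π ω ∘ f)
    (hπ.comp (measurable_fst.prodMk (hf.measurable.comp measurable_snd)))

end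

theorem theorem1p2
    {E Y Λ : Type*}
    [MetricSpace E] [CompleteSpace E] [TopologicalSpace.SeparableSpace E]
    [MeasurableSpace E] [BorelSpace E]
    [MetricSpace Y] [TopologicalSpace.SeparableSpace Y] [MeasurableSpace Y] [BorelSpace Y]
    [MeasurableSpace Λ] (P : Measure Λ) [IsProbabilityMeasure P]
    (X : Set E) (hX : AnalyticSet X)
    (π : Λ → X → Y) (hπ : Measurable (Function.uncurry π))
    (α κ C : ℝ) (hα : 0 < α) (hκ : 0 < κ) (hC : 0 < C)
    (htrans : IsTransversal P π α κ C)
    (hdim : ENNReal.ofReal (α * κ) < dimH X) :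
    (∀ η : Measure Y, IsKappaRegular κ η →
      ∀ᵐ ω ∂P, 0 < η (Set.range (π ω))) ∧
    (∀ η : Measure Y, IsStronglyKappaRegular κ η → SigmaFinite η →
      AEMeasurable (fun ω => (η (Set.range (π ω)))⁻¹) P ∧
      ∫⁻ ω, (η (Set.range (π ω)))⁻¹ ∂P < ∞) :=
  theorem1p2_general (analyticSet_univ_coe hX) P π hπ α κ C (mul_pos hα hκ) hC htrans
    (hdim.trans_eq (dimH_univ_coe X).symm)
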